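/- **Setting.** Let $\Omega\subset\mathbb R^{n}\times\mathbb R^{m}$ be an open set with coordinates $x_1,\dots,x_n,v^1,\dots,v^m$ (an adapted chart of a fiber bundle $E\to M$ with $\dim M=n$ and $m$-dimensional fibers). On the infinite jet space of connections $\nabla(\partial_{x_i})=\partial_{x_i}+\sum_\alpha v_i^\alpha\partial_{v^\alpha}$ over $\Omega$, whose coordinates are $x_i,v^\alpha$ and the derivatives $v^\alpha_{i,\sigma}$ of $v_i^\alpha$ along all multi-indices $\sigma$ in $x,v$, let $D_{x_i},D_{v^\alpha}$ be the total derivatives, and let $\mathcal E_{\mathrm{fc}}$ be the infinite prolongation of the equation of flat connections $$\frac{\partial v_j^\alpha}{\partial x_i}+\sum_\beta v_i^\beta\frac{\partial v_j^\alpha}{\partial v^\beta}=\frac{\partial v_i^\alpha}{\partial x_j}+\sum_\beta v_j^\beta\frac{\partial v_i^\alpha}{\partial v^\beta}.$$ $C^\infty(\mathcal E_{\mathrm{fc}})$ consists of the restrictions to $\mathcal E_{\mathrm{fc}}$ of smooth functions of finitely many jet coordinates, vector fields on $\mathcal E_{\mathrm{fc}}$ are derivations of this algebra, the Cartan distribution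 is the module generated by the total derivatives, and a symmetry is a vector field that annihilates all functions of $(x,v)$ and preserves the Cartan distribution under commutation. Put $$D_i=D_{x_i}+\sum_\beta v_i^\beta D_{v^\beta},\qquad \bar U_{\mathrm{fc}}=\sum_i dx_i\otimes D_i,\qquad V_h=\sum_\alpha h^\alpha D_{v^\alpha}\quad\text{for } h=(h^1,\dots,h^m)\in C^\infty(\mathcal E_{\mathrm{fc}})^m .$$ The generating section of a symmetry $S$ is $\sum_{i,\alpha}S(v_i^\alpha)\,dx_i\otimes D_{v^\alpha}$. For words $I=i_1\dots i_k$ and $A=\alpha_1\dots\alpha_l$ put $v_I^{\alpha,A}=D_{v^{\alpha_1}}\cdots D_{v^{\alpha_l}}D_{i_1}\cdots D_{i_k}(v^\alpha)$ and $D_{v^A}=D_{v^{\alpha_1}}\circ\dots\circ D_{v^{\alpha_l}}$. **Proposition 4.4 (prop:Lie-str).** The total derivatives restrict to vector fields on $\mathcal E_{\mathrm{fc}}$, and the following holds. 1. For each $h\in C^\infty(\mathcal E_{\mathrm{fc}})^m$ there is exactly one symmetry $S_h$ of $\mathcal E_{\mathrm{fc}}$ whose generating section is the Nijenhuis bracket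 $[\![\bar U_{\mathrm{fc}},V_h]\!]$. The map $h\mapsto S_h$ is $\mathbb R$-linear, and it is injective if $n\ge 1$. Under this identification of $m$-tuples of functions with symmetries, the commutator of symmetries is the bracket of tuples $$[S_f,S_g]=S_{\{f,g\}},\qquad \{f,g\}^\alpha=S_fg^\alpha-S_gf^\alpha+V_fg^\alpha-V_gf^\alpha .$$ 2. The functions $v_I^{\alpha,A}$ do not depend on the order of the letters in $I$ and in $A$. The functions $x_i$, $v^\alpha$ and $v_I^{\alpha,A}$ with $|I|>0$ ($I$, $A$ unordered multi-indices) form a coordinate system on $\mathcal E_{\mathrm{fc}}$, in the sense that there are vector fields $\partial/\partial y_c$ on $\mathcal E_{\mathrm{fc}}$, indexed by these functions $y_c$, with $\partial y_{c'}/\partial y_c=\delta_{cc'}$, such that for each $F\in C^\infty(\mathcal E_{\mathrm{fc}})$ only finitely many $\partial F/\partial y_c$ are nonzero and $X(F)=\sum_c X(y_c)\,\partial F/\partial y_c$ for every vector field $X$. In these coordinates $S_h=\sum_{\alpha,A,\,|I|>0}S_I^{\alpha,A}\,\partial/\partial v_I^{\alpha,A}$, where the coefficients $S_I^{\alpha,A}=S_h(v_I^{\alpha,A})$,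 defined for all $I$ and $A$, satisfy $$S_I^{\alpha,A}=D_{v^A}(S_I^{\alpha,\varnothing}),\qquad S_{Ii}^{\alpha,\varnothing}=D_i(S_I^{\alpha,\varnothing})+\sum_{\beta=1}^m v_I^{\alpha,\beta}\zeta_i^\beta,$$ with $\zeta_i^\beta=S_i^{\beta,\varnothing}=D_i(h^\beta)-\sum_{\gamma=1}^m v_i^{\beta,\gamma}h^\gamma$. -/

import Mathlib

open scoped ContDiff

noncomputable section

namespace FlatConn

/-- Indices of the coordinates on the total space of the bundle: `Sum.inl i` stands for `x_i`,
`Sum.inr α` for the fibre coordinate `v^α`. -/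
abbrev BaseIdx (n m : ℕ) : Type := Fin n ⊕ Fin m

/-- Indices of the adapted coordinates on the infinite jet space of the bundle of connections:
`Sum.inl κ` is a coordinate of the base point (`x_i` or `v^α`), while `Sum.inr (i, α, σ)` is the
jet coordinate `v^α_{i,σ}`, the derivative of the connection coefficient `v_i^α` along the
unordered multi-index `σ` in the variables `x` and `v`. -/
abbrev JetIdx (n m : ℕ) : Type :=
  BaseIdx n m ⊕ (Fin n × Fin m × Multiset (BaseIdx n m))

/-- Values of all adapted coordinates. -/
abbrev Jet (n m : ℕ) : Type := JetIdx n m → ℝ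

variable {n m : ℕ}

/-- The projection of a jet to its base point. -/
def base (θ : Jet n m) : BaseIdx n m → ℝ := fun κ => θ (Sum.inl κ)

/-- The infinite jet space over the coordinate domain `Ω`. -/
def jetSpace (Ω : Set (BaseIdx n m → ℝ)) : Set (Jet n m) := {θ | base θ ∈ Ω}

/-- `F` is a smooth function of finitely many adapted coordinates on the jet space over `Ω`
(its values elsewhere are irrelevant). -/
def JetSmooth (Ω : Set (BaseIdx n m → ℝ)) (F : Jet n m → ℝ) : Prop :=
  ∃ (s : Finset (JetIdx n m)) (G : (s → ℝ) → ℝ),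
    ContDiffOn ℝ ∞ G (s.restrict '' jetSpace Ω) ∧ ∀ θ ∈ jetSpace Ω, F θ = G (s.restrict θ)

/-- Partial derivative with respect to one adapted coordinate. -/
def jetPartial (c : JetIdx n m) (F : Jet n m → ℝ) (θ : Jet n m) : ℝ :=
  deriv (fun t => F (Function.update θ c t)) (θ c)

/-- The total derivative `D_{x_i}` or `D_{v^α}` on the infinite jet space,
`D_κ = ∂_κ + ∑ v^α_{i,σκ} ∂/∂v^α_{i,σ}`. -/
def jetTotal (κ : BaseIdx n m) (F : Jet n m → ℝ) (θ : Jet n m) : ℝ :=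
  jetPartial (Sum.inl κ) F θ +
    ∑ᶠ q : Fin n × Fin m × Multiset (BaseIdx n m),
      θ (Sum.inr (q.1, q.2.1, κ ::ₘ q.2.2)) * jetPartial (Sum.inr q) F θ

/-- The left-hand side minus the right-hand side of the equation of flat connections
`∂v_j^α/∂x_i + ∑_β v_i^β ∂v_j^α/∂v^β = ∂v_i^α/∂x_j + ∑_β v_j^β ∂v_i^α/∂v^β`. -/
def curvature (i j : Fin n) (α : Fin m) (θ : Jet n m) : ℝ :=
  (θ (Sum.inr (j, α, {Sum.inl i})) +
      ∑ β : Fin m, θ (Sum.inr (i, β, 0)) * θ (Sum.inr (j, α, {Sum.inr β}))) -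
  (θ (Sum.inr (i, α, {Sum.inl j})) +
      ∑ β : Fin m, θ (Sum.inr (j, β, 0)) * θ (Sum.inr (i, α, {Sum.inr β})))

/-- The infinite prolongation of the equation of flat connections: the jets at which the equation
and all its differential consequences hold. -/
def flatEq (Ω : Set (BaseIdx n m → ℝ)) : Set (Jet n m) :=
  {θ | θ ∈ jetSpace Ω ∧ ∀ (i j : Fin n) (α : Fin m) (l : List (BaseIdx n m)),
    l.foldr jetTotal (curvature i j α) θ = 0}

/-! ### Smooth functions and vector fields on the equation -/

theorem JetSmooth.exists_of_subset {Ω : Set (BaseIdx n m → ℝ)} {s t : Finset (JetIdx n m)}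
    (hst : s ⊆ t) {G : (s → ℝ) → ℝ} (hG : ContDiffOn ℝ ∞ G (s.restrict '' jetSpace Ω)) :
    ContDiffOn ℝ ∞ (fun y : t → ℝ => G (fun c => y ⟨c.1, hst c.2⟩)) (t.restrict '' jetSpace Ω) := by
  refine ContDiffOn.comp hG (g := G) (f := fun (y : t → ℝ) (c : s) => y ⟨c.1, hst c.2⟩) ?_ ?_
  · exact (contDiff_pi.2 fun c => contDiff_apply ℝ ℝ _).contDiffOn
  · rintro _ ⟨θ, hθ, rfl⟩
    exact ⟨θ, hθ, rfl⟩

theorem JetSmooth.map₂ {Ω : Set (BaseIdx n m → ℝ)} {F H : Jet n m → ℝ} (hF : JetSmooth Ω F)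
    (hH : JetSmooth Ω H) {op : ℝ → ℝ → ℝ} (hop : ContDiff ℝ ∞ fun p : ℝ × ℝ => op p.1 p.2) :
    JetSmooth Ω fun θ => op (F θ) (H θ) := by
  obtain ⟨s, G, hG, hFG⟩ := hF
  obtain ⟨t, K, hK, hHK⟩ := hH
  refine ⟨s ∪ t, fun y => op (G fun c => y ⟨c.1, Finset.subset_union_left c.2⟩)
    (K fun c => y ⟨c.1, Finset.subset_union_right c.2⟩), ?_, ?_⟩
  · exact hop.comp_contDiffOn ((exists_of_subset Finset.subset_union_left hG).prodMk
      (exists_of_subset Finset.subset_union_right hK))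
  · intro θ hθ
    simp only [hFG θ hθ, hHK θ hθ]
    rfl

theorem JetSmooth.const (Ω : Set (BaseIdx n m → ℝ)) (r : ℝ) :
    JetSmooth Ω fun _ : Jet n m => r :=
  ⟨∅, fun _ => r, contDiffOn_const, fun _ _ => rfl⟩

theorem JetSmooth.coord (Ω : Set (BaseIdx n m → ℝ)) (c : JetIdx n m) :
    JetSmooth Ω fun θ : Jet n m => θ c :=
  ⟨{c}, fun y => y ⟨c, Finset.mem_singleton_self c⟩, (contDiff_apply ℝ ℝ _).contDiffOn,
    fun _ _ => rfl⟩

/-- `C^∞` of the equation: restrictions to it of smooth functions on the infinite jet space. -/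
def SmoothFun (Ω : Set (BaseIdx n m → ℝ)) : Subalgebra ℝ (flatEq Ω → ℝ) where
  carrier := {f | ∃ F : Jet n m → ℝ, JetSmooth Ω F ∧ ∀ θ : flatEq Ω, f θ = F θ}
  mul_mem' := by
    rintro f g ⟨F, hF, hf⟩ ⟨H, hH, hg⟩
    exact ⟨fun θ => F θ * H θ, hF.map₂ hH (contDiff_fst.mul contDiff_snd),
      fun θ => by simp [hf, hg]⟩
  add_mem' := by
    rintro f g ⟨F, hF, hf⟩ ⟨H, hH, hg⟩
    exact ⟨fun θ => F θ + H θ, hF.map₂ hH (contDiff_fst.add contDiff_snd),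
      fun θ => by simp [hf, hg]⟩
  algebraMap_mem' r := ⟨fun _ => r, JetSmooth.const Ω r, fun _ => rfl⟩

/-- Vector fields on the equation: derivations of its algebra of smooth functions. -/
abbrev VectorField (Ω : Set (BaseIdx n m → ℝ)) : Type :=
  Derivation ℝ (SmoothFun Ω) (SmoothFun Ω)

variable {Ω : Set (BaseIdx n m → ℝ)}

/-- An adapted coordinate restricted to the equation. -/
def coord (Ω : Set (BaseIdx n m → ℝ)) (c : JetIdx n m) : SmoothFun Ω :=
  ⟨fun θ => θ.1 c, fun θ => θ c, JetSmooth.coord Ω c, fun _ => rfl⟩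

/-- The coordinate `x_i`. -/
def xCoord (Ω : Set (BaseIdx n m → ℝ)) (i : Fin n) : SmoothFun Ω := coord Ω (Sum.inl (Sum.inl i))

/-- The coordinate `v^α`. -/
def vCoord (Ω : Set (BaseIdx n m → ℝ)) (α : Fin m) : SmoothFun Ω := coord Ω (Sum.inl (Sum.inr α))

/-- The connection coefficient `v_i^α`. -/
def connCoeff (Ω : Set (BaseIdx n m → ℝ)) (i : Fin n) (α : Fin m) : SmoothFun Ω :=
  coord Ω (Sum.inr (i, α, 0))

/-- `X` is the restriction to the equation of the total derivative along `κ`. As every smooth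
function on the equation is the restriction of some `F`, there is at most one such `X`. -/
def IsTotalDerivative (κ : BaseIdx n m) (X : VectorField Ω) : Prop :=
  ∀ (f : SmoothFun Ω) (F : Jet n m → ℝ), JetSmooth Ω F → (∀ θ : flatEq Ω, f.1 θ = F θ) →
    ∀ θ : flatEq Ω, (X f).1 θ = jetTotal κ F θ

/-! In the definitions below `D κ` is the total derivative along `κ` on the equation. -/

/-- The Cartan distribution of the equation. -/
def cartan (D : BaseIdx n m → VectorField Ω) : Submodule (SmoothFun Ω) (VectorField Ω) :=
  Submodule.span (SmoothFun Ω) (Set.range D)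

/-- A symmetry of the equation: a vector field that annihilates the functions of the base point
`(x, v)` and preserves the Cartan distribution. -/
structure IsSymmetry (D : BaseIdx n m → VectorField Ω) (S : VectorField Ω) : Prop where
  vertical : ∀ (f : SmoothFun Ω) (g : (BaseIdx n m → ℝ) → ℝ), ContDiffOn ℝ ∞ g Ω →
    (∀ θ : flatEq Ω, f.1 θ = g (base θ.1)) → S f = 0
  preserves : ∀ Y ∈ cartan D, ⁅S, Y⁆ ∈ cartan D

/-- `D_i = D_{x_i} + ∑_β v_i^β D_{v^β}`, the value of the canonical flat connection on `∂/∂x_i`. -/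
def hor (D : BaseIdx n m → VectorField Ω) (i : Fin n) : VectorField Ω :=
  D (Sum.inl i) + ∑ β : Fin m, connCoeff Ω i β • D (Sum.inr β)

/-- `V_h = ∑_α h^α D_{v^α}`. -/
def vert (D : BaseIdx n m → VectorField Ω) (h : Fin m → SmoothFun Ω) : VectorField Ω :=
  ∑ α : Fin m, h α • D (Sum.inr α)

/-- The vector-valued horizontal form `Ū = ∑_i dx_i ⊗ D_i`, as a map `Z ↦ ∑_i dx_i(Z) D_i`. -/
def connForm (D : BaseIdx n m → VectorField Ω) (Z : VectorField Ω) : VectorField Ω :=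
  ∑ i : Fin n, Z (xCoord Ω i) • hor D i

/-- The Nijenhuis bracket `⟦K, V⟧` of a vector-valued `1`-form `K` with a vector field `V`. -/
def nijenhuis (K : VectorField Ω → VectorField Ω) (V Z : VectorField Ω) : VectorField Ω :=
  ⁅K Z, V⁆ - K ⁅Z, V⁆

/-- The vector-valued horizontal form `∑_{i,α} φ_i^α dx_i ⊗ D_{v^α}`. -/
def vertForm (D : BaseIdx n m → VectorField Ω) (φ : Fin n → Fin m → SmoothFun Ω)
    (Z : VectorField Ω) : VectorField Ω :=
  ∑ i : Fin n, ∑ α : Fin m, (Z (xCoord Ω i) * φ i α) • D (Sum.inr α)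

/-- `S` is a symmetry whose generating section `∑_{i,α} S(v_i^α) dx_i ⊗ D_{v^α}` is the
coboundary `⟦Ū, V_h⟧`. -/
def IsSymmetryOf (D : BaseIdx n m → VectorField Ω) (h : Fin m → SmoothFun Ω)
    (S : VectorField Ω) : Prop :=
  IsSymmetry D S ∧
    vertForm D (fun i α => S (connCoeff Ω i α)) = nijenhuis (connForm D) (vert D h)

/-- The bracket `{f, g}^α = S_f g^α - S_g f^α + V_f g^α - V_g f^α`. -/
def bracket (D : BaseIdx n m → VectorField Ω) (S : (Fin m → SmoothFun Ω) → VectorField Ω)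
    (f g : Fin m → SmoothFun Ω) (α : Fin m) : SmoothFun Ω :=
  S f (g α) - S g (f α) + vert D f (g α) - vert D g (f α)

/-! ### Special coordinates -/

/-- `D_{v^A} = D_{v^{α_1}} ∘ ⋯ ∘ D_{v^{α_l}}` for the word `A = α_1 … α_l`. -/
def vertIter (D : BaseIdx n m → VectorField Ω) (A : List (Fin m)) (f : SmoothFun Ω) :
    SmoothFun Ω :=
  A.foldr (fun α g => D (Sum.inr α) g) f

/-- `D_I = D_{i_1} ∘ ⋯ ∘ D_{i_k}` for the word `I = i_1 … i_k`. -/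
def horIter (D : BaseIdx n m → VectorField Ω) (I : List (Fin n)) (f : SmoothFun Ω) :
    SmoothFun Ω :=
  I.foldr (fun i g => hor D i g) f

/-- `v_I^{α,A} = D_{v^A} D_I (v^α)`. -/
def special (D : BaseIdx n m → VectorField Ω) (α : Fin m) (I : List (Fin n)) (A : List (Fin m)) :
    SmoothFun Ω :=
  vertIter D A (horIter D I (vCoord Ω α))

/-- Unordered multi-indices `(α, I, A)` with `|I| > 0`. -/
abbrev SpecialIdx (n m : ℕ) : Type :=
  {q : Fin m × Multiset (Fin n) × Multiset (Fin m) // q.2.1 ≠ 0}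

/-- The system of functions `x_i`, `v^α` and `v_I^{α,A}`, `|I| > 0`. -/
def specialSystem (D : BaseIdx n m → VectorField Ω) :
    BaseIdx n m ⊕ SpecialIdx n m → SmoothFun Ω
  | Sum.inl κ => coord Ω (Sum.inl κ)
  | Sum.inr q => special D q.1.1 q.1.2.1.toList q.1.2.2.toList

/-- `P c = ∂/∂y_c` are the coordinate vector fields of the coordinate system `y`: they are dual
to `y`, each function depends on finitely many of the `y_c`, and every vector field is
`X = ∑_c X(y_c) ∂/∂y_c`. -/
structure IsCoordinateFrame {ι : Type} [DecidableEq ι] (y : ι → SmoothFun Ω)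
    (P : ι → VectorField Ω) : Prop where
  dual : ∀ c c' : ι, P c (y c') = if c = c' then 1 else 0
  finite : ∀ f : SmoothFun Ω, {c | P c f ≠ 0}.Finite
  expand : ∀ (X : VectorField Ω) (f : SmoothFun Ω), X f = ∑ᶠ c, X (y c) * P c f

end FlatConn

end

noncomputable section

namespace FlatConn

/-! ### Iterated derivations -/

section Iter

variable {ι R R' : Type*} [CommRing R] [Algebra ℝ R] [CommRing R'] [Algebra ℝ R']

/-! The proof rests on a polynomial model of the equation, generated by the special coordinates.
There `D_{v^β}` adds `β` to the index `A`. Since `D_{x_i} = D_i - ∑_β v_i^β D_{v^β}` and `D_i v_I^α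
= v_{iI}^α`, the value of `D_{x_i}` on `v_I^{α,A}` must be `D_{v^A}(v_{iI}^α - ∑_β v_i^β
v_I^{α,β})`. These derivations commute and the connection is flat (`modelFlatSystem`). The notion
`FlatSystem` covers the model, the jet polynomials modulo the differential ideal of the curvature,
and the equation itself; the model maps to every flat system (`FlatSystem.aeval_modelD`). Comparing
the first two shows that on the equation special and jet coordinates are polynomials in each other
(`ofJet_toJet`, `toJet_ofJet`), with the special ones subject only to the base point lying in `Ω`.

Hadamard's lemma and a cutoff give every algebraic derivation the chain rule (`exists_chain_rule`).
So a vector field is determined by its components in special coordinates (`vectorField_ext`), and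
these can be prescribed at will (`fieldOf`); the coordinate frame and the total derivatives arise
this way.

For symmetries, `[D_i, V_h] = ∑_β ζ_i^β D_{v^β}` (`FlatSystem.horD_vertD`), so the Nijenhuis bracket
has components `ζ`. Hence `S_h` is the vertical field that commutes with the total derivatives and
sends `v_i^α` to `ζ_i^α`; then `S_h + V_h` commutes with each `D_i`. As it maps `v^α` to `h^α`, this
dictates `S_h(D_I v^α) = D_I h^α - V_h(D_I v^α)`, whence existence and the recursion. The commutator
of `S_f + V_f` and `S_g + V_g` again commutes with each `D_i` and equals `[S_f, S_g] + V_{f,g}`,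
where `V_{f,g}` has the components `{f,g}^α`; this is the bracket formula.

Injectivity: if `S_h = 0`, then `D_i h^α = ∑_γ v_i^{α,γ} h^γ`. The left side raises the highest
order `|I|` occurring in `h`, the right side does not, so `h` depends on `x, v` only; comparing
coefficients of `v_i^{γ,γ}` gives `h = 0`. -/

/-- The composition of derivations along a word. -/
def iter (d : ι → Derivation ℝ R R) (l : List ι) (f : R) : R := l.foldr (fun i g => d i g) f

@[simp] theorem iter_nil (d : ι → Derivation ℝ R R) (f : R) : iter d [] f = f := rfl

@[simp] theorem iter_cons (d : ι → Derivation ℝ R R) (i : ι) (l : List ι) (f : R) :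
    iter d (i :: l) f = d i (iter d l f) := rfl

theorem iter_perm {d : ι → Derivation ℝ R R} (hd : ∀ i j f, d i (d j f) = d j (d i f))
    {l l' : List ι} (h : l.Perm l') (f : R) : iter d l f = iter d l' f := by
  induction h with
  | nil => rfl
  | cons i _ ih => simp [ih]
  | swap i j l => simp [hd]
  | trans _ _ ih ih' => exact ih.trans ih'

theorem apply_iter {d : ι → Derivation ℝ R R} {E : Derivation ℝ R R}
    (h : ∀ i f, E (d i f) = d i (E f)) (l : List ι) (f : R) :
    E (iter d l f) = iter d l (E f) := by
  induction l with
  | nil => rfl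
  | cons i l ih => simp [h, ih]

theorem map_iter {d : ι → Derivation ℝ R R} {d' : ι → Derivation ℝ R' R'} (φ : R →ₐ[ℝ] R')
    (h : ∀ i f, φ (d i f) = d' i (φ f)) (l : List ι) (f : R) :
    φ (iter d l f) = iter d' l (φ f) := by
  induction l with
  | nil => rfl
  | cons i l ih => simp [h, ih]

theorem iter_smul (d : ι → Derivation ℝ R R) (l : List ι) (r : ℝ) (f : R) :
    iter d l (r • f) = r • iter d l f := by
  induction l with
  | nil => rfl
  | cons i l ih => simp [ih]

theorem derivation_sum_apply {κ : Type*} (s : Finset κ) (E : κ → Derivation ℝ R R) (f : R) :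
    (∑ k ∈ s, E k) f = ∑ k ∈ s, E k f := by
  classical
  induction s using Finset.induction_on with
  | empty => simp
  | insert a s ha ih => simp [Finset.sum_insert ha, ih]

theorem map_derivation_of_generators {σ : Type*}
    {E : Derivation ℝ (MvPolynomial σ ℝ) (MvPolynomial σ ℝ)}
    {E' : Derivation ℝ R R} (φ : MvPolynomial σ ℝ →ₐ[ℝ] R)
    (h : ∀ c, φ (E (MvPolynomial.X c)) = E' (φ (MvPolynomial.X c))) (p : MvPolynomial σ ℝ) :
    φ (E p) = E' (φ p) := by
  induction p using MvPolynomial.induction_on with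
  | C a => simp [← MvPolynomial.algebraMap_eq]
  | add p q hp hq => simp [hp, hq]
  | mul_X p c hp => simp [hp, h]

end Iter

/-! ### Systems of commuting derivations with a flat connection -/

section FlatSystem

variable {n m : ℕ} {R R' : Type*} [CommRing R] [Algebra ℝ R] [CommRing R'] [Algebra ℝ R']

/-- `D_i = d_{x_i} + ∑_β v_i^β d_{v^β}`. -/
def horD (d : BaseIdx n m → Derivation ℝ R R) (v : Fin n → Fin m → R) (i : Fin n) :
    Derivation ℝ R R :=
  d (Sum.inl i) + ∑ β : Fin m, v i β • d (Sum.inr β)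

theorem horD_apply (d : BaseIdx n m → Derivation ℝ R R) (v : Fin n → Fin m → R) (i : Fin n)
    (f : R) : horD d v i f = d (Sum.inl i) f + ∑ β : Fin m, v i β * d (Sum.inr β) f := by
  simp [horD, derivation_sum_apply]

/-- `d_{v^A} D_I (w^α)`. -/
def specialOf (d : BaseIdx n m → Derivation ℝ R R) (w : BaseIdx n m → R) (v : Fin n → Fin m → R)
    (α : Fin m) (I : List (Fin n)) (A : List (Fin m)) : R :=
  iter (fun β => d (Sum.inr β)) A (iter (horD d v) I (w (Sum.inr α)))

theorem map_horD {d : BaseIdx n m → Derivation ℝ R R} {d' : BaseIdx n m → Derivation ℝ R' R'}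
    {v : Fin n → Fin m → R} {v' : Fin n → Fin m → R'} (φ : R →ₐ[ℝ] R')
    (h : ∀ κ f, φ (d κ f) = d' κ (φ f)) (hv : ∀ i α, φ (v i α) = v' i α) (i : Fin n) (f : R) :
    φ (horD d v i f) = horD d' v' i (φ f) := by
  simp [horD_apply, h, hv]

theorem map_specialOf {d : BaseIdx n m → Derivation ℝ R R}
    {d' : BaseIdx n m → Derivation ℝ R' R'} {w : BaseIdx n m → R} {w' : BaseIdx n m → R'}
    {v : Fin n → Fin m → R} {v' : Fin n → Fin m → R'} (φ : R →ₐ[ℝ] R')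
    (h : ∀ κ f, φ (d κ f) = d' κ (φ f)) (hw : ∀ κ, φ (w κ) = w' κ)
    (hv : ∀ i α, φ (v i α) = v' i α) (α : Fin m) (I : List (Fin n)) (A : List (Fin m)) :
    φ (specialOf d w v α I A) = specialOf d' w' v' α I A := by
  rw [specialOf, map_iter φ (fun β => h (Sum.inr β)), map_iter φ (map_horD φ h hv), hw]
  rfl

/-- Commuting derivations `d_κ` dual to functions `w^κ`, and coefficients `v_i^α` of a flat
connection. -/
structure FlatSystem (d : BaseIdx n m → Derivation ℝ R R) (w : BaseIdx n m → R)
    (v : Fin n → Fin m → R) : Prop where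
  comm : ∀ κ μ f, d κ (d μ f) = d μ (d κ f)
  dual : ∀ κ μ, d κ (w μ) = if μ = κ then 1 else 0
  flat : ∀ i j α, horD d v i (v j α) = horD d v j (v i α)

namespace FlatSystem

variable {d : BaseIdx n m → Derivation ℝ R R} {w : BaseIdx n m → R} {v : Fin n → Fin m → R}

/-- Flatness is exactly the symmetry in `i, j` of the first-order terms `D_i(v_j^β) d_{v^β} f`; the
remaining terms are symmetric because the `d_κ` commute. -/
theorem horD_comm (H : FlatSystem d w v) (i j : Fin n) (f : R) :
    horD d v i (horD d v j f) = horD d v j (horD d v i f) := by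
  have key : ∀ i j, horD d v i (horD d v j f) = d (Sum.inl i) (d (Sum.inl j) f) +
      (∑ β, v i β * d (Sum.inr β) (d (Sum.inl j) f) +
        ∑ β, v j β * d (Sum.inr β) (d (Sum.inl i) f)) +
      ∑ β, horD d v i (v j β) * d (Sum.inr β) f +
      ∑ β, ∑ γ, v i β * v j γ * d (Sum.inr β) (d (Sum.inr γ) f) := by
    intro i j
    rw [horD_apply d v j, map_add, map_sum, horD_apply d v i (d _ f)]
    simp only [Derivation.leibniz, smul_eq_mul]
    simp only [Finset.sum_add_distrib, horD_apply d v i (d _ f), mul_add, Finset.mul_sum]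
    rw [Finset.sum_comm (γ := Fin m)]
    simp only [fun β => H.comm (Sum.inl i) (Sum.inr β) f, fun β => mul_comm (d (Sum.inr β) f),
      mul_left_comm, mul_assoc]
    ring_nf
  have h₁ : ∑ β, horD d v i (v j β) * d (Sum.inr β) f =
      ∑ β, horD d v j (v i β) * d (Sum.inr β) f := by simp only [H.flat i j]
  have h₂ : ∑ β, ∑ γ, v i β * v j γ * d (Sum.inr β) (d (Sum.inr γ) f) =
      ∑ β, ∑ γ, v j β * v i γ * d (Sum.inr β) (d (Sum.inr γ) f) := by
    rw [Finset.sum_comm]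
    refine Finset.sum_congr rfl fun β _ => Finset.sum_congr rfl fun γ _ => ?_
    rw [H.comm (Sum.inr _) (Sum.inr _), mul_comm (v i γ)]
  rw [key i j, key j i, h₁, h₂, H.comm (Sum.inl i) (Sum.inl j)]
  ring

theorem horD_inr (H : FlatSystem d w v) (i : Fin n) (α : Fin m) :
    horD d v i (w (Sum.inr α)) = v i α := by
  simp [horD_apply, H.dual]

theorem horD_inl (H : FlatSystem d w v) (i j : Fin n) :
    horD d v i (w (Sum.inl j)) = if j = i then 1 else 0 := by
  simp [horD_apply, H.dual]

theorem specialOf_perm (H : FlatSystem d w v) (α : Fin m) {I I' : List (Fin n)}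
    {A A' : List (Fin m)} (hI : I.Perm I') (hA : A.Perm A') :
    specialOf d w v α I A = specialOf d w v α I' A' := by
  rw [specialOf, specialOf, iter_perm (fun _ _ => H.comm _ _) hA, iter_perm H.horD_comm hI]

theorem specialOf_singleton (H : FlatSystem d w v) (α : Fin m) (i : Fin n) (A : List (Fin m)) :
    specialOf d w v α [i] A = iter (fun β => d (Sum.inr β)) A (v i α) := by
  simp [specialOf, H.horD_inr]

end FlatSystem

end FlatSystem

/-! ### The polynomial model: total derivatives in special coordinates -/

section Model

open MvPolynomial

variable {n m : ℕ}

/-- Indices of the special coordinates. -/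
abbrev ModelIdx (n m : ℕ) : Type := BaseIdx n m ⊕ SpecialIdx n m

/-- Polynomials in the special coordinates. -/
abbrev ModelPoly (n m : ℕ) : Type := MvPolynomial (ModelIdx n m) ℝ

/-- The generator `v_I^{α,A}`, `|I| > 0`. -/
def modelY (α : Fin m) (I : Multiset (Fin n)) (A : Multiset (Fin m)) (hI : I ≠ 0) :
    ModelPoly n m :=
  X (Sum.inr ⟨(α, I, A), hI⟩)

theorem modelY_congr (α : Fin m) {I I' : Multiset (Fin n)} {A A' : Multiset (Fin m)} (hI : I ≠ 0)
    (h : I = I') (h' : A = A') : modelY α I A hI = modelY α I' A' (h ▸ hI) := by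
  subst h h'; rfl

/-- The connection coefficient `v_i^α`. -/
def modelV (i : Fin n) (α : Fin m) : ModelPoly n m :=
  modelY α {i} 0 (Multiset.singleton_ne_zero i)

/-- The total derivative `D_{v^β}`. -/
def modelVert (β : Fin m) : Derivation ℝ (ModelPoly n m) (ModelPoly n m) :=
  mkDerivation ℝ fun
    | Sum.inl κ => if κ = Sum.inr β then 1 else 0
    | Sum.inr q => modelY q.1.1 q.1.2.1 (β ::ₘ q.1.2.2) q.2

/-- The total derivative `D_{x_i}`. -/
def modelBase (i : Fin n) : Derivation ℝ (ModelPoly n m) (ModelPoly n m) :=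
  mkDerivation ℝ fun
    | Sum.inl κ => if κ = Sum.inl i then 1 else 0
    | Sum.inr q => iter modelVert q.1.2.2.toList
        (modelY q.1.1 (i ::ₘ q.1.2.1) 0 (Multiset.cons_ne_zero) -
          ∑ β, modelV i β * modelY q.1.1 q.1.2.1 {β} q.2)

/-- The total derivatives in special coordinates. -/
def modelD : BaseIdx n m → Derivation ℝ (ModelPoly n m) (ModelPoly n m) :=
  Sum.elim modelBase modelVert

@[simp] theorem modelVert_base (β : Fin m) (κ : BaseIdx n m) :
    modelVert β (X (Sum.inl κ) : ModelPoly n m) = if κ = Sum.inr β then 1 else 0 :=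
  mkDerivation_X _ _ _

@[simp] theorem modelVert_modelY (α β : Fin m) (I : Multiset (Fin n)) (A : Multiset (Fin m))
    (hI : I ≠ 0) : modelVert β (modelY α I A hI) = modelY α I (β ::ₘ A) hI :=
  mkDerivation_X _ _ _

@[simp] theorem modelBase_base (i : Fin n) (κ : BaseIdx n m) :
    modelBase i (X (Sum.inl κ) : ModelPoly n m) = if κ = Sum.inl i then 1 else 0 :=
  mkDerivation_X _ _ _

theorem modelBase_modelY (i : Fin n) (α : Fin m) (I : Multiset (Fin n)) (A : Multiset (Fin m))
    (hI : I ≠ 0) : modelBase i (modelY α I A hI) = iter modelVert A.toList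
      (modelY α (i ::ₘ I) 0 Multiset.cons_ne_zero - ∑ β, modelV i β * modelY α I {β} hI) :=
  mkDerivation_X _ _ _

/-- The commutator is itself a derivation, so generators suffice. -/
theorem commute_of_X {σ : Type*} {d e : Derivation ℝ (MvPolynomial σ ℝ) (MvPolynomial σ ℝ)}
    (h : ∀ c, d (e (X c)) = e (d (X c))) (f : MvPolynomial σ ℝ) : d (e f) = e (d f) := by
  have : ⁅d, e⁆ = 0 := derivation_ext fun c => by
    simp [Derivation.commutator_apply, h]
  have := congrArg (fun D => D f) this
  simpa [Derivation.commutator_apply, sub_eq_zero] using this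

theorem modelVert_comm (β γ : Fin m) (f : ModelPoly n m) :
    modelVert β (modelVert γ f) = modelVert γ (modelVert β f) := by
  refine commute_of_X (fun c => ?_) f
  rcases c with κ | ⟨⟨α, I, A⟩, hI⟩
  · simp only [modelVert_base]
    split_ifs <;> simp
  · change modelVert β (modelVert γ (modelY α I A hI)) = modelVert γ (modelVert β (modelY α I A hI))
    simp only [modelVert_modelY, Multiset.cons_swap]

theorem iter_modelVert_modelY (l : List (Fin m)) (α : Fin m) (I : Multiset (Fin n))
    (A : Multiset (Fin m)) (hI : I ≠ 0) :
    iter modelVert l (modelY α I A hI) = modelY α I (l + A) hI := by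
  induction l with
  | nil => simp [modelY]
  | cons β l ih => simp [ih, ← Multiset.cons_coe]

/-- Built into the definition: `modelBase i` on `v_I^{α,A}` is the `A`-fold vertical derivative of
its value at `A = 0`. -/
theorem modelBase_modelVert (i : Fin n) (β : Fin m) (f : ModelPoly n m) :
    modelBase i (modelVert β f) = modelVert β (modelBase i f) := by
  refine commute_of_X (fun c => ?_) f
  rcases c with κ | ⟨⟨α, I, A⟩, hI⟩
  · simp only [modelVert_base, modelBase_base]
    split_ifs <;> simp
  · change modelBase i (modelVert β (modelY α I A hI)) = modelVert β (modelBase i (modelY α I A hI))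
    rw [modelVert_modelY, modelBase_modelY, modelBase_modelY, ← iter_cons]
    refine iter_perm modelVert_comm ?_ _
    rw [← Multiset.coe_eq_coe]
    simp [← Multiset.cons_coe]

theorem modelBase_modelY_zero (i : Fin n) (α : Fin m) (I : Multiset (Fin n)) (hI : I ≠ 0) :
    modelBase i (modelY α I 0 hI) =
      modelY α (i ::ₘ I) 0 Multiset.cons_ne_zero - ∑ β, modelV i β * modelY α I {β} hI := by
  rw [modelBase_modelY, Multiset.toList_zero, iter_nil]

theorem modelBase_modelY_singleton (i : Fin n) (α β : Fin m) (I : Multiset (Fin n)) (hI : I ≠ 0) :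
    modelBase i (modelY α I {β} hI) = modelY α (i ::ₘ I) {β} Multiset.cons_ne_zero -
      ∑ γ, (modelY γ {i} {β} (Multiset.singleton_ne_zero i) * modelY α I {γ} hI +
        modelV i γ * modelY α I (β ::ₘ {γ}) hI) := by
  rw [modelBase_modelY, Multiset.toList_singleton, iter_cons, iter_nil, map_sub, map_sum]
  congr 1
  · rw [modelVert_modelY]; rfl
  · refine Finset.sum_congr rfl fun γ _ => ?_
    simp only [Derivation.leibniz, smul_eq_mul, modelV, modelVert_modelY]
    rw [modelY_congr γ (A := β ::ₘ 0) (A' := {β}) _ rfl rfl]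
    ring

theorem modelBase_comm (i j : Fin n) (f : ModelPoly n m) :
    modelBase i (modelBase j f) = modelBase j (modelBase i f) := by
  refine commute_of_X (fun c => ?_) f
  rcases c with κ | ⟨⟨α, I, A⟩, hI⟩
  · simp only [modelBase_base]
    split_ifs <;> simp
  · replace hI : I ≠ 0 := hI
    -- Both derivations commute with the vertical ones, so only the case `A = 0` needs a
    -- computation.
    have hX : X (Sum.inr ⟨(α, I, A), hI⟩) = iter modelVert A.toList (modelY α I 0 hI) := by
      rw [iter_modelVert_modelY]
      simp [modelY]
    rw [hX, apply_iter (modelBase_modelVert j), apply_iter (modelBase_modelVert i),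
      apply_iter (modelBase_modelVert i), apply_iter (modelBase_modelVert j)]
    congr 1
    -- The terms are grouped so that swapping `i` and `j` exchanges the sums within each bracket;
    -- the other terms are symmetric because multi-indices are unordered.
    have key : ∀ i j : Fin n, modelBase i (modelBase j (modelY α I 0 hI)) =
        modelY α (i ::ₘ j ::ₘ I) 0 Multiset.cons_ne_zero -
        (∑ β, modelV i β * modelY α (j ::ₘ I) {β} Multiset.cons_ne_zero +
          ∑ β, modelV j β * modelY α (i ::ₘ I) {β} Multiset.cons_ne_zero) -
        ∑ β, modelY β (i ::ₘ j ::ₘ 0) 0 Multiset.cons_ne_zero * modelY α I {β} hI +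
        (∑ β, ∑ γ, modelV i γ * modelY β {j} {γ} (Multiset.singleton_ne_zero j) *
            modelY α I {β} hI +
          ∑ β, ∑ γ, modelV j γ * modelY β {i} {γ} (Multiset.singleton_ne_zero i) *
            modelY α I {β} hI) +
        ∑ β, ∑ γ, modelV j β * modelV i γ * modelY α I (β ::ₘ {γ}) hI := by
      intro i j
      rw [modelBase_modelY_zero, map_sub, map_sum, modelBase_modelY_zero]
      simp only [Derivation.leibniz, smul_eq_mul, modelBase_modelY_singleton]
      rw [Finset.sum_comm (f := fun β γ => modelV j γ * modelY β {i} {γ} _ * modelY α I {β} hI)]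
      simp only [modelV, modelBase_modelY_zero, Finset.sum_add_distrib, mul_sub, mul_add,
        Finset.sum_sub_distrib, Finset.mul_sum]
      simp only [mul_comm (modelY α I _ hI), mul_assoc, mul_left_comm]
      have : ∀ β : Fin m, modelY β (i ::ₘ {j}) 0 Multiset.cons_ne_zero =
        modelY β (i ::ₘ j ::ₘ 0) 0 Multiset.cons_ne_zero := fun β => rfl
      simp only [this]
      ring_nf
      exact congrArg _ (Finset.sum_congr rfl fun β _ => Finset.sum_congr rfl fun γ _ => by ring)
    have h₁ : ∑ β, ∑ γ, modelV j β * modelV i γ * modelY α I (β ::ₘ {γ}) hI =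
        ∑ β, ∑ γ, modelV i β * modelV j γ * modelY α I (β ::ₘ {γ}) hI := by
      rw [Finset.sum_comm]
      refine Finset.sum_congr rfl fun β _ => Finset.sum_congr rfl fun γ _ => ?_
      have : modelY α I (γ ::ₘ {β}) hI = modelY α I (β ::ₘ {γ}) hI :=
        modelY_congr α hI rfl (Multiset.cons_swap γ β 0)
      rw [mul_comm (modelV j γ), this]
    rw [key i j, key j i, h₁]
    have h₂ : ∀ (β : Fin m) (K : Multiset (Fin n)),
        modelY β (i ::ₘ j ::ₘ K) 0 Multiset.cons_ne_zero =
        modelY β (j ::ₘ i ::ₘ K) 0 Multiset.cons_ne_zero := fun β K =>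
      modelY_congr _ _ (Multiset.cons_swap i j K) rfl
    simp only [h₂]
    ring

theorem horD_modelY (i : Fin n) (α : Fin m) (I : Multiset (Fin n)) (hI : I ≠ 0) :
    horD modelD modelV i (modelY α I 0 hI) = modelY α (i ::ₘ I) 0 Multiset.cons_ne_zero := by
  rw [horD_apply]
  change modelBase i _ + ∑ β, modelV i β * modelVert β _ = _
  simp only [modelBase_modelY_zero, modelVert_modelY]
  exact sub_add_cancel _ _

/-- Flatness holds because `D_i v_j^α` and `D_j v_i^α` are the same generator `v_{ij}^α`. -/
theorem modelFlatSystem :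
    FlatSystem (R := ModelPoly n m) modelD (fun κ => X (Sum.inl κ)) modelV where
  comm κ μ f := by
    rcases κ with i | β <;> rcases μ with j | γ
    · exact modelBase_comm i j f
    · exact modelBase_modelVert i γ f
    · exact (modelBase_modelVert j β f).symm
    · exact modelVert_comm β γ f
  dual κ μ := by
    rcases κ with i | β
    · exact modelBase_base i μ
    · exact modelVert_base β μ
  flat i j α := by
    rw [modelV, modelV, horD_modelY, horD_modelY]
    exact modelY_congr _ _ (Multiset.cons_swap i j 0) rfl

theorem iter_horD_model (α : Fin m) (l : List (Fin n)) (hl : (l : Multiset (Fin n)) ≠ 0) :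
    iter (horD modelD modelV) l (X (Sum.inl (Sum.inr α))) = modelY α l 0 hl := by
  induction l with
  | nil => exact absurd rfl hl
  | cons i l ih =>
    rw [iter_cons]
    rcases eq_or_ne (l : Multiset (Fin n)) 0 with h | h
    · obtain rfl : l = [] := by simpa using h
      exact modelFlatSystem.horD_inr i α
    · rw [ih h, horD_modelY]; rfl

theorem specialOf_model (q : SpecialIdx n m) :
    specialOf (R := ModelPoly n m) modelD (fun κ => X (Sum.inl κ)) modelV q.1.1 q.1.2.1.toList
      q.1.2.2.toList = X (Sum.inr q) := by
  obtain ⟨⟨α, I, A⟩, hI⟩ := q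
  rw [specialOf, iter_horD_model _ _ (by simpa using hI)]
  change iter modelVert _ _ = _
  rw [iter_modelVert_modelY]
  simp [modelY]

end Model

/-! ### Special coordinates on the equation -/

section Equation

open MvPolynomial

variable {n m : ℕ}

/-- Polynomials in the adapted jet coordinates. -/
abbrev JetPoly (n m : ℕ) : Type := MvPolynomial (JetIdx n m) ℝ

/-- The total derivatives on polynomials in the jet coordinates. -/
def jetD (κ : BaseIdx n m) : Derivation ℝ (JetPoly n m) (JetPoly n m) :=
  mkDerivation ℝ fun
    | Sum.inl μ => if μ = κ then 1 else 0
    | Sum.inr q => X (Sum.inr (q.1, q.2.1, κ ::ₘ q.2.2))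

@[simp] theorem jetD_base (κ μ : BaseIdx n m) :
    jetD κ (X (Sum.inl μ)) = if μ = κ then 1 else 0 := mkDerivation_X _ _ _

@[simp] theorem jetD_jet (κ : BaseIdx n m) (i : Fin n) (α : Fin m)
    (σ : Multiset (BaseIdx n m)) :
    jetD κ (X (Sum.inr (i, α, σ))) = X (Sum.inr (i, α, κ ::ₘ σ)) := mkDerivation_X _ _ _

theorem jetD_comm (κ μ : BaseIdx n m) (f : JetPoly n m) :
    jetD κ (jetD μ f) = jetD μ (jetD κ f) := by
  refine commute_of_X (fun c => ?_) f
  rcases c with ν | ⟨i, α, σ⟩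
  · simp only [jetD_base]
    split_ifs <;> simp
  · simp only [jetD_jet, Multiset.cons_swap]

theorem iter_jetD (l : List (BaseIdx n m)) (i : Fin n) (α : Fin m)
    (σ : Multiset (BaseIdx n m)) :
    iter jetD l (X (Sum.inr (i, α, σ))) = X (Sum.inr (i, α, l + σ)) := by
  induction l with
  | nil => simp
  | cons κ l ih => simp [ih, ← Multiset.cons_coe]

/-- The curvature as a polynomial in the jet coordinates. -/
def curvPoly (i j : Fin n) (α : Fin m) : JetPoly n m :=
  (X (Sum.inr (j, α, {Sum.inl i})) +
      ∑ β : Fin m, X (Sum.inr (i, β, 0)) * X (Sum.inr (j, α, {Sum.inr β}))) -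
  (X (Sum.inr (i, α, {Sum.inl j})) +
      ∑ β : Fin m, X (Sum.inr (j, β, 0)) * X (Sum.inr (i, α, {Sum.inr β})))

/-- The connection coefficient as a polynomial in the jet coordinates. -/
abbrev jetV (i : Fin n) (α : Fin m) : JetPoly n m := X (Sum.inr (i, α, 0))

/-- Identifies the curvature with the defect of the `flat` axiom. -/
theorem curvPoly_eq (i j : Fin n) (α : Fin m) :
    curvPoly i j α = horD jetD jetV i (jetV j α) - horD jetD jetV j (jetV i α) := by
  simp only [horD_apply, curvPoly, jetV, jetD_jet]
  rfl

theorem hasDerivAt_eval_update {σ : Type*} [DecidableEq σ] (c : σ) (k : σ → ℝ)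
    (p : MvPolynomial σ ℝ) : HasDerivAt (fun t => eval (Function.update k c t) p)
      (eval k (pderiv c p)) (k c) := by
  induction p using MvPolynomial.induction_on with
  | C a => simpa using hasDerivAt_const (k c) a
  | add p q hp hq => simpa using hp.fun_add hq
  | mul_X p d hp =>
    have hX : HasDerivAt (fun t => Function.update k c t d)
        (eval k (pderiv c (X d : MvPolynomial σ ℝ)))
        (k c) := by
      rcases eq_or_ne d c with rfl | h
      · simpa using hasDerivAt_id' (k d)
      · simpa [h, pderiv_X_of_ne h] using hasDerivAt_const (k c) (k d)
    have := hp.fun_mul hX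
    simp only [Function.update_eq_self] at this
    simp only [map_mul, eval_X, Derivation.leibniz, smul_eq_mul, map_add]
    refine this.congr_deriv ?_
    ring

theorem jetPartial_eval (c : JetIdx n m) (p : JetPoly n m) (θ : Jet n m) :
    jetPartial c (fun θ => eval θ p) θ = eval θ (pderiv c p) :=
  (hasDerivAt_eval_update c θ p).deriv

/-- The finite counterpart of the infinite sum that defines `jetTotal`. -/
theorem jetD_eq_sum (κ : BaseIdx n m) (p : JetPoly n m) :
    jetD κ p = ∑ c ∈ p.vars, pderiv c p * jetD κ (X c) := by
  have h : ∀ q : JetPoly n m, (∑ c ∈ p.vars, jetD κ (X c) • pderiv c) q =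
      ∑ c ∈ p.vars, pderiv c q * jetD κ (X c) := fun q => by
    rw [derivation_sum_apply]
    exact Finset.sum_congr rfl fun c _ => by simp [mul_comm]
  rw [← h]
  refine derivation_eq_of_forall_mem_vars fun c hc => ?_
  rw [h]
  classical
  simp [pderiv_X, Pi.single_apply, hc]

/-- This turns the differential consequences of the equation into polynomial identities, so that
membership in `flatEq` becomes algebra. -/
theorem jetTotal_eval (κ : BaseIdx n m) (p : JetPoly n m) :
    jetTotal κ (fun θ => eval θ p) = fun θ => eval θ (jetD κ p) := by
  classical
  funext θ
  simp only [jetTotal, jetPartial_eval]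
  have hsub : (Function.support fun q : Fin n × Fin m × Multiset (BaseIdx n m) =>
      θ (Sum.inr (q.1, q.2.1, κ ::ₘ q.2.2)) * eval θ (pderiv (Sum.inr q) p)) ⊆
      (p.vars.toRight : Set _) := by
    intro q hq
    by_contra h
    refine hq ?_
    simp only [Finset.mem_coe, Finset.mem_toRight] at h
    simp [pderiv_eq_zero_of_notMem_vars h]
  rw [finsum_eq_sum_of_support_subset _ hsub, jetD_eq_sum,
    ← Finset.toLeft_disjSum_toRight (u := p.vars), Finset.sum_disjSum]
  simp only [map_add, map_sum, map_mul, jetD_base, Finset.toLeft_disjSum_toRight]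
  congr 1
  · simp only [apply_ite (eval θ), map_one, map_zero, mul_ite, mul_one, mul_zero,
      Finset.sum_ite_eq', Finset.mem_toLeft]
    split_ifs with h
    · rfl
    · simp [pderiv_eq_zero_of_notMem_vars h]
  · refine Finset.sum_congr (by simp) fun q _ => ?_
    rw [mul_comm, show q = (q.1, q.2.1, q.2.2) from rfl, jetD_jet, eval_X]

theorem curvature_eq (i j : Fin n) (α : Fin m) :
    (curvature i j α : Jet n m → ℝ) = fun θ => eval θ (curvPoly i j α) := by
  funext θ
  simp [curvature, curvPoly]

theorem foldr_jetTotal (l : List (BaseIdx n m)) (p : JetPoly n m) :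
    l.foldr jetTotal (fun θ => eval θ p) = fun θ => eval θ (iter jetD l p) := by
  induction l with
  | nil => rfl
  | cons κ l ih => rw [List.foldr_cons, ih, jetTotal_eval]; rfl

theorem mem_flatEq_iff {Ω : Set (BaseIdx n m → ℝ)} {θ : Jet n m} : θ ∈ flatEq Ω ↔ base θ ∈ Ω ∧
    ∀ (i j : Fin n) (α : Fin m) (l : List (BaseIdx n m)),
      eval θ (iter jetD l (curvPoly i j α)) = 0 := by
  simp only [flatEq, curvature_eq, foldr_jetTotal]
  rfl

/-- The differential ideal generated by the curvature. -/
def flatIdeal (n m : ℕ) : Ideal (JetPoly n m) :=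
  Ideal.span {p | ∃ i j α l, p = iter jetD l (curvPoly i j α)}

theorem jetD_mem_flatIdeal (κ : BaseIdx n m) {p : JetPoly n m} (hp : p ∈ flatIdeal n m) :
    jetD κ p ∈ flatIdeal n m := by
  induction hp using Submodule.span_induction with
  | mem p hp =>
    obtain ⟨i, j, α, l, rfl⟩ := hp
    exact Ideal.subset_span ⟨i, j, α, κ :: l, rfl⟩
  | zero => simp
  | add p q _ _ hp hq => rw [map_add]; exact add_mem hp hq
  | smul a p hp' hp =>
    simp only [smul_eq_mul, Derivation.leibniz]
    exact add_mem (Ideal.mul_mem_left _ _ hp)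
      (Ideal.mul_mem_right _ _ hp')

/-- Polynomial functions on the equation. -/
abbrev FlatPoly (n m : ℕ) : Type := JetPoly n m ⧸ flatIdeal n m

/-- The quotient map. -/
abbrev flatMk (n m : ℕ) : JetPoly n m →ₐ[ℝ] FlatPoly n m := Ideal.Quotient.mkₐ ℝ (flatIdeal n m)

theorem flatMk_eq_zero {p : JetPoly n m} : flatMk n m p = 0 ↔ p ∈ flatIdeal n m :=
  Ideal.Quotient.eq_zero_iff_mem

theorem flatMk_jetD_eq_zero (κ : BaseIdx n m) (p : JetPoly n m) (hp : flatMk n m p = 0) :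
    flatMk n m (jetD κ p) = 0 :=
  flatMk_eq_zero.2 (jetD_mem_flatIdeal κ (flatMk_eq_zero.1 hp))

/-- The total derivatives of polynomial functions on the equation. -/
def flatD (κ : BaseIdx n m) : Derivation ℝ (FlatPoly n m) (FlatPoly n m) :=
  Derivation.liftOfSurjective (f := flatMk n m) (Ideal.Quotient.mkₐ_surjective ℝ _)
    (flatMk_jetD_eq_zero κ)

theorem flatMk_jetD (κ : BaseIdx n m) (p : JetPoly n m) :
    flatMk n m (jetD κ p) = flatD κ (flatMk n m p) :=
  (Derivation.liftOfSurjective_apply (f := flatMk n m) (Ideal.Quotient.mkₐ_surjective ℝ _)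
    (flatMk_jetD_eq_zero κ) p).symm

/-- Dividing by the differential ideal makes the curvature vanish identically, so the universal
property of the model applies to the quotient. -/
theorem flatFlatSystem : FlatSystem (R := FlatPoly n m) flatD
    (fun κ => flatMk n m (X (Sum.inl κ))) (fun i α => flatMk n m (jetV i α)) where
  comm κ μ f := by
    obtain ⟨p, rfl⟩ := Ideal.Quotient.mkₐ_surjective ℝ (flatIdeal n m) f
    rw [← flatMk_jetD, ← flatMk_jetD, ← flatMk_jetD, ← flatMk_jetD, jetD_comm]
  dual κ μ := by
    rw [← flatMk_jetD, jetD_base]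
    split_ifs <;> simp
  flat i j α := by
    rw [← map_horD (flatMk n m) flatMk_jetD (fun _ _ => rfl),
      ← map_horD (flatMk n m) flatMk_jetD (fun _ _ => rfl), ← sub_eq_zero, ← map_sub,
      ← curvPoly_eq]
    exact flatMk_eq_zero.2 (Ideal.subset_span ⟨i, j, α, [], rfl⟩)

section Generic

variable {R : Type*} [CommRing R] [Algebra ℝ R] {d : BaseIdx n m → Derivation ℝ R R}
  {w : BaseIdx n m → R} {v : Fin n → Fin m → R}

/-- The special functions of a system of derivations. -/
def specialFun (d : BaseIdx n m → Derivation ℝ R R) (w : BaseIdx n m → R)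
    (v : Fin n → Fin m → R) : ModelIdx n m → R
  | Sum.inl κ => w κ
  | Sum.inr q => specialOf d w v q.1.1 q.1.2.1.toList q.1.2.2.toList

theorem FlatSystem.aeval_modelY (H : FlatSystem d w v) (α : Fin m) (I : List (Fin n))
    (A : List (Fin m)) (hI : (I : Multiset (Fin n)) ≠ 0) :
    aeval (specialFun d w v) (modelY α I A hI) = specialOf d w v α I A := by
  rw [modelY, aeval_X]
  refine H.specialOf_perm α ?_ ?_ <;> rw [← Multiset.coe_eq_coe] <;> simp

theorem FlatSystem.aeval_modelV (H : FlatSystem d w v) (i : Fin n) (α : Fin m) :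
    aeval (specialFun d w v) (modelV i α) = v i α := by
  have := H.aeval_modelY α [i] [] (by simp)
  rw [H.specialOf_singleton] at this
  exact this

theorem FlatSystem.aeval_modelVert (H : FlatSystem d w v) (β : Fin m) (f : ModelPoly n m) :
    aeval (specialFun d w v) (modelVert β f) = d (Sum.inr β) (aeval (specialFun d w v) f) := by
  refine map_derivation_of_generators _ (fun c => ?_) f
  rcases c with κ | ⟨⟨α, I, A⟩, hI⟩
  · rw [modelVert_base, aeval_X, specialFun, H.dual]
    split_ifs <;> simp
  · obtain ⟨I, rfl⟩ := Quotient.exists_rep I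
    obtain ⟨A, rfl⟩ := Quotient.exists_rep A
    replace hI : (I : Multiset (Fin n)) ≠ 0 := hI
    change aeval _ (modelVert β (modelY α (I : Multiset (Fin n)) (A : Multiset (Fin m)) hI)) =
      d _ (aeval _ (modelY α (I : Multiset (Fin n)) (A : Multiset (Fin m)) hI))
    rw [modelVert_modelY, Multiset.cons_coe, H.aeval_modelY, H.aeval_modelY]
    rfl

/-- In any flat system `d_{x_i} = D_i - ∑_β v_i^β d_{v^β}` commutes with the vertical derivations;
evaluated on `d_{v^A} D_I w^α` this is the formula that defines `modelBase`. -/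
theorem FlatSystem.aeval_modelBase (H : FlatSystem d w v) (i : Fin n) (f : ModelPoly n m) :
    aeval (specialFun d w v) (modelBase i f) = d (Sum.inl i) (aeval (specialFun d w v) f) := by
  refine map_derivation_of_generators _ (fun c => ?_) f
  rcases c with κ | ⟨⟨α, I, A⟩, hI⟩
  · rw [modelBase_base, aeval_X, specialFun, H.dual]
    split_ifs <;> simp
  · obtain ⟨I, rfl⟩ := Quotient.exists_rep I
    obtain ⟨A, rfl⟩ := Quotient.exists_rep A
    replace hI : (I : Multiset (Fin n)) ≠ 0 := hI
    change aeval _ (modelBase i (modelY α (I : Multiset (Fin n)) (A : Multiset (Fin m)) hI)) =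
      d _ (aeval _ (modelY α (I : Multiset (Fin n)) (A : Multiset (Fin m)) hI))
    rw [H.aeval_modelY, specialOf, apply_iter (fun β f => H.comm _ _ f), modelBase_modelY,
      map_iter _ H.aeval_modelVert, map_sub, map_sum]
    have h₁ : d (Sum.inl i) (iter (horD d v) I (w (Sum.inr α))) =
        specialOf d w v α (i :: I) [] - ∑ β, v i β * specialOf d w v α I [β] := by
      simp only [specialOf, iter_nil, iter_cons, horD_apply]
      ring
    rw [h₁]
    have h₂ := H.aeval_modelY α (i :: I) [] (by simp)
    have h₃ : ∀ β, aeval (specialFun d w v) (modelY α (I : Multiset (Fin n)) {β} hI) =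
      specialOf d w v α I [β] := fun β => H.aeval_modelY α I [β] hI
    rw [← h₂]
    simp only [map_mul, H.aeval_modelV, h₃]
    refine iter_perm (fun _ _ => H.comm _ _) ?_ _
    rw [← Multiset.coe_eq_coe]
    simp

theorem FlatSystem.aeval_modelD (H : FlatSystem d w v) (κ : BaseIdx n m) (f : ModelPoly n m) :
    aeval (specialFun d w v) (modelD κ f) = d κ (aeval (specialFun d w v) f) := by
  rcases κ with i | β
  · exact H.aeval_modelBase i f
  · exact H.aeval_modelVert β f

end Generic

/-- The jet coordinates of the equation as polynomials in the special coordinates. -/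
def jetToModel : JetIdx n m → ModelPoly n m
  | Sum.inl κ => X (Sum.inl κ)
  | Sum.inr q => iter modelD q.2.2.toList (modelV q.1 q.2.1)

theorem jetToModel_cons (i : Fin n) (α : Fin m) (κ : BaseIdx n m) (σ : Multiset (BaseIdx n m)) :
    jetToModel (Sum.inr (i, α, κ ::ₘ σ)) = modelD κ (jetToModel (Sum.inr (i, α, σ))) := by
  change iter modelD (κ ::ₘ σ).toList _ = modelD κ (iter modelD σ.toList _)
  rw [← iter_cons]
  refine iter_perm modelFlatSystem.comm ?_ _
  rw [← Multiset.coe_eq_coe]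
  simp [← Multiset.cons_coe]

theorem jetToModel_zero (i : Fin n) (α : Fin m) :
    jetToModel (Sum.inr (i, α, 0)) = modelV i α := by
  simp [jetToModel]

theorem aeval_jetD (κ : BaseIdx n m) (p : JetPoly n m) :
    aeval jetToModel (jetD κ p) = modelD κ (aeval jetToModel p) := by
  refine map_derivation_of_generators _ (fun c => ?_) p
  rcases c with μ | ⟨i, α, σ⟩
  · rw [jetD_base, aeval_X, jetToModel, modelFlatSystem.dual]
    split_ifs <;> simp
  · rw [jetD_jet, aeval_X, aeval_X, jetToModel_cons]

/-- The special coordinates as polynomials in the jet coordinates. -/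
def modelToJet : ModelIdx n m → JetPoly n m :=
  specialFun jetD (fun κ => X (Sum.inl κ)) jetV

/-- The substitution intertwines the total derivatives, so it carries special functions of the jets
to those of the model, which are its generators. -/
theorem aeval_modelToJet (c : ModelIdx n m) : aeval jetToModel (modelToJet c) = X c := by
  rcases c with κ | q
  · exact aeval_X _ _
  · rw [← specialOf_model]
    exact map_specialOf _ aeval_jetD (fun κ => aeval_X _ _)
      (fun i α => by rw [aeval_X, jetToModel_zero]) _ _ _

/-- The point of the equation with given special coordinates. -/
def toJet (k : ModelIdx n m → ℝ) : Jet n m := fun c => eval k (jetToModel c)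

/-- The special coordinates of a jet. -/
def ofJet (θ : Jet n m) : ModelIdx n m → ℝ := fun c => eval θ (modelToJet c)

theorem eval_toJet (k : ModelIdx n m → ℝ) (p : JetPoly n m) :
    eval (toJet k) p = eval k (aeval jetToModel p) := by
  induction p using MvPolynomial.induction_on with
  | C a => simp
  | add p q hp hq => simp [hp, hq]
  | mul_X p c hp => simp [hp, toJet]

theorem eval_ofJet (θ : Jet n m) (p : ModelPoly n m) :
    eval (ofJet θ) p = eval θ (aeval modelToJet p) := by
  induction p using MvPolynomial.induction_on with
  | C a => simp
  | add p q hp hq => simp [hp, hq]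
  | mul_X p c hp => simp [hp, ofJet]

theorem ofJet_toJet (k : ModelIdx n m → ℝ) : ofJet (toJet k) = k := by
  funext c
  rw [ofJet, eval_toJet, aeval_modelToJet, eval_X]

theorem base_toJet (k : ModelIdx n m → ℝ) : base (toJet k) = fun κ => k (Sum.inl κ) := by
  funext κ
  simp [base, toJet, jetToModel]

/-- After substitution the curvature vanishes identically by flatness of the model, and so do its
total derivatives: the special coordinates satisfy no relation. -/
theorem toJet_mem {Ω : Set (BaseIdx n m → ℝ)} {k : ModelIdx n m → ℝ}
    (hk : (fun κ => k (Sum.inl κ)) ∈ Ω) : toJet k ∈ flatEq Ω := by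
  refine mem_flatEq_iff.2 ⟨by rwa [base_toJet], fun i j α l => ?_⟩
  have h : ∀ i α, aeval jetToModel (jetV i α : JetPoly n m) = modelV i α := fun i α => by
    rw [aeval_X, jetToModel_zero]
  rw [eval_toJet, map_iter _ aeval_jetD, curvPoly_eq, map_sub, map_horD _ aeval_jetD h,
    map_horD _ aeval_jetD h, h, h, modelFlatSystem.flat, sub_self]
  have : iter modelD l (0 : ModelPoly n m) = 0 := by
    simpa using iter_smul modelD l 0 (0 : ModelPoly n m)
  rw [this, map_zero]

theorem eval_eq_zero_of_mem_flatIdeal {Ω : Set (BaseIdx n m → ℝ)} {θ : Jet n m}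
    (hθ : θ ∈ flatEq Ω) {p : JetPoly n m} (hp : p ∈ flatIdeal n m) : eval θ p = 0 := by
  have : flatIdeal n m ≤ RingHom.ker (eval θ) := by
    refine Ideal.span_le.2 ?_
    rintro _ ⟨i, j, α, l, rfl⟩
    exact (mem_flatEq_iff.1 hθ).2 i j α l
  exact this hp

/-- The identity already holds for polynomials modulo `flatIdeal`, whose elements vanish on the
equation. There the substitution of special functions intertwines `modelD` with `flatD` and recovers
each jet coordinate as an iterated derivative of `v_i^α`. -/
theorem toJet_ofJet {Ω : Set (BaseIdx n m → ℝ)} {θ : Jet n m} (hθ : θ ∈ flatEq Ω) :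
    toJet (ofJet θ) = θ := by
  funext c
  rw [toJet, eval_ofJet, ← sub_eq_zero, ← eval_X (f := θ) c, ← map_sub]
  refine eval_eq_zero_of_mem_flatIdeal hθ (flatMk_eq_zero.1 ?_)
  rw [map_sub, sub_eq_zero]
  have h : (flatMk n m).comp (aeval modelToJet) = aeval (specialFun flatD
      (fun κ => flatMk n m (X (Sum.inl κ))) (fun i α => flatMk n m (jetV i α))) := by
    refine algHom_ext fun c => ?_
    rw [AlgHom.comp_apply, aeval_X, aeval_X]
    rcases c with κ | q
    · rfl
    · exact map_specialOf (w := fun κ => X (Sum.inl κ)) (v := jetV) (flatMk n m) flatMk_jetD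
        (fun _ => rfl) (fun _ _ => rfl) _ _ _
  rw [← AlgHom.comp_apply, h]
  rcases c with κ | ⟨i, α, σ⟩
  · exact aeval_X _ _
  · change aeval _ (iter modelD σ.toList (modelV i α)) = _
    rw [map_iter _ flatFlatSystem.aeval_modelD, flatFlatSystem.aeval_modelV,
      ← map_iter (flatMk n m) flatMk_jetD, iter_jetD]
    simp

end Equation

/-! ### Hadamard's lemma -/

section Hadamard

open MeasureTheory Set

/-- The integral is the value at `0` of the convolution of the indicator of `(0, 1]` with `u ↦ g p
(-u)`, cut off to compact support; smoothness in the parameter is then that of convolutions. -/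
theorem contDiff_integral_unitInterval {P : Type*} [NormedAddCommGroup P] [NormedSpace ℝ P]
    {g : P → ℝ → ℝ} (hg : ContDiff ℝ ∞ fun q : P × ℝ => g q.1 q.2) :
    ContDiff ℝ ∞ fun p => ∫ t in (0 : ℝ)..1, g p t := by
  -- The bump equals `1` on `[-1, 1]`, so the cutoff does not change the integrand on `(0, 1]`.
  let ψ : ContDiffBump (0 : ℝ) := ⟨1, 2, one_pos, one_lt_two⟩
  let f : ℝ → ℝ := indicator (Ioc 0 1) fun _ => 1
  have hf : LocallyIntegrable f volume := by
    refine Integrable.locallyIntegrable ?_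
    rw [integrable_indicator_iff measurableSet_Ioc]
    exact integrableOn_const (by simp)
  have key := contDiffOn_convolution_right_with_param_comp (𝕜 := ℝ) (μ := volume) (n := ⊤)
    (ContinuousLinearMap.mul ℝ ℝ) (s := (univ : Set P)) (v := fun _ => (0 : ℝ))
    contDiffOn_const (f := f) (g := fun p u => ψ u * g p (-u)) (k := Metric.closedBall 0 2)
    isOpen_univ (isCompact_closedBall _ _) ?_ hf ?_
  · refine contDiffOn_univ.1 (key.congr fun p _ => ?_)
    rw [convolution_def, intervalIntegral.integral_of_le zero_le_one,
      ← integral_indicator measurableSet_Ioc]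
    refine integral_congr_ae (Filter.Eventually.of_forall fun t => ?_)
    by_cases ht : t ∈ Ioc (0 : ℝ) 1
    · have : ψ (0 - t) = 1 := by
        refine ψ.one_of_mem_closedBall ?_
        change 0 - t ∈ Metric.closedBall (0 : ℝ) 1
        rw [Metric.mem_closedBall, Real.dist_eq]
        rw [sub_zero, zero_sub, abs_neg, abs_of_pos ht.1]
        exact ht.2
      simp [f, ht, this, -zero_sub]
    · simp [f, ht]
  · intro p x _ hx
    have : ψ x = 0 := ψ.zero_of_le_dist (by simpa using (not_le.1 fun h => hx (by simpa using h)).le)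
    simp [this]
  · refine ContDiff.contDiffOn ?_
    exact (ψ.contDiff.comp contDiff_snd).mul (hg.comp (contDiff_fst.prodMk contDiff_snd.neg))

theorem clm_apply_eq_sum_single {ι : Type*} [Fintype ι] [DecidableEq ι] (L : (ι → ℝ) →L[ℝ] ℝ)
    (y : ι → ℝ) : L y = ∑ i, y i * L (Pi.single i 1) := by
  conv_lhs => rw [← Finset.univ_sum_single y]
  rw [map_sum]
  refine Finset.sum_congr rfl fun i _ => ?_
  have : (Pi.single i (y i) : ι → ℝ) = y i • Pi.single i (1 : ℝ) := by
    rw [← Pi.single_smul]; simp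
  rw [this, map_smul, smul_eq_mul]

/-- Integrate the derivative of `G` along the segment from `a` to `y`. The factorisation makes
Leibniz' rule alone compute a derivation at a point, without any continuity of the derivation. -/
theorem exists_hadamard {ι : Type*} [Fintype ι] [DecidableEq ι] {G : (ι → ℝ) → ℝ}
    (hG : ContDiff ℝ ∞ G) (a : ι → ℝ) : ∃ H : ι → (ι → ℝ) → ℝ, (∀ i, ContDiff ℝ ∞ (H i)) ∧
      (∀ y, G y = G a + ∑ i, (y i - a i) * H i y) ∧
      ∀ i, H i a = fderiv ℝ G a (Pi.single i 1) := by
  have hd : ContDiff ℝ ∞ (fderiv ℝ G) := hG.fderiv_right (by simp)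
  have hline : ContDiff ℝ ∞ fun q : (ι → ℝ) × ℝ => a + q.2 • (q.1 - a) :=
    contDiff_const.add (contDiff_snd.smul (contDiff_fst.sub contDiff_const))
  have hint : ∀ i, ContDiff ℝ ∞ fun q : (ι → ℝ) × ℝ =>
      fderiv ℝ G (a + q.2 • (q.1 - a)) (Pi.single i 1) := fun i =>
    (hd.comp hline).clm_apply contDiff_const
  refine ⟨fun i y => ∫ t in (0 : ℝ)..1, fderiv ℝ G (a + t • (y - a)) (Pi.single i 1),
    fun i => contDiff_integral_unitInterval (hint i), fun y => ?_, fun i => by simp⟩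
  have hder : ∀ t : ℝ, HasDerivAt (fun t : ℝ => G (a + t • (y - a)))
      (fderiv ℝ G (a + t • (y - a)) (y - a)) t := fun t => by
    have h₁ : HasDerivAt (fun t : ℝ => a + t • (y - a)) (y - a) t := by
      simpa using ((hasDerivAt_id' t).smul_const (y - a)).const_add a
    exact ((hG.differentiable (by simp)).differentiableAt.hasFDerivAt).comp_hasDerivAt t h₁
  have hdec : ∀ t : ℝ, fderiv ℝ G (a + t • (y - a)) (y - a) =
      ∑ i, (y i - a i) * fderiv ℝ G (a + t • (y - a)) (Pi.single i 1) := fun t =>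
    clm_apply_eq_sum_single _ _
  have hcont : ∀ i, Continuous fun t : ℝ => fderiv ℝ G (a + t • (y - a)) (Pi.single i 1) := fun i =>
    (hint i).continuous.comp (Continuous.prodMk_right y)
  have := intervalIntegral.integral_eq_sub_of_hasDerivAt (a := 0) (b := 1)
    (fun t _ => hder t) ?_
  · simp only [hdec] at this
    rw [intervalIntegral.integral_finsetSum fun i _ =>
      ((hcont i).const_mul _).intervalIntegrable _ _] at this
    simp only [intervalIntegral.integral_const_mul, one_smul, zero_smul, add_zero,
      add_sub_cancel] at this
    linarith
  · simp only [hdec]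
    exact (continuous_finsetSum _ fun i _ => (hcont i).const_mul _).intervalIntegrable _ _

end Hadamard

/-! ### Smooth functions on the jet space -/

section Smooth

variable {n m : ℕ} {Ω : Set (BaseIdx n m → ℝ)}

theorem continuous_base : Continuous (base : Jet n m → _) :=
  continuous_pi fun _ => continuous_apply _

theorem isOpen_restrict_jetSpace (hΩ : IsOpen Ω) (s : Finset (JetIdx n m)) :
    IsOpen (s.restrict '' jetSpace Ω) := by
  rw [isOpen_iff_mem_nhds]
  rintro _ ⟨θ, hθ, rfl⟩
  -- A continuous section of the projection through `θ`: the coordinates outside `s` stay frozen at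
  -- those of `θ`.
  let e : (s → ℝ) → Jet n m := fun y c => if h : c ∈ s then y ⟨c, h⟩ else θ c
  have he : Continuous e := by
    refine continuous_pi fun c => ?_
    by_cases h : c ∈ s
    · simpa [e, h] using continuous_apply _
    · simpa [e, h] using continuous_const
  have heθ : e (s.restrict θ) = θ := by
    funext c
    by_cases h : c ∈ s <;> simp [e, h]
  have hopen : IsOpen (e ⁻¹' jetSpace Ω) := (hΩ.preimage continuous_base).preimage he
  refine Filter.mem_of_superset (hopen.mem_nhds (by simpa [heθ] using hθ)) ?_
  intro y hy
  refine ⟨e y, hy, ?_⟩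
  funext c
  simp [e]

theorem JetSmooth.mul {F H : Jet n m → ℝ} (hF : JetSmooth Ω F) (hH : JetSmooth Ω H) :
    JetSmooth Ω fun θ => F θ * H θ :=
  hF.map₂ hH (contDiff_fst.mul contDiff_snd)

theorem JetSmooth.sum {ι : Type*} (s : Finset ι) {F : ι → Jet n m → ℝ}
    (hF : ∀ c ∈ s, JetSmooth Ω (F c)) : JetSmooth Ω fun θ => ∑ c ∈ s, F c θ := by
  classical
  induction s using Finset.induction_on with
  | empty => simpa using JetSmooth.const Ω 0
  | insert a s ha ih =>
    simp only [Finset.sum_insert ha]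
    exact (hF a (Finset.mem_insert_self a s)).map₂
      (ih fun c hc => hF c (Finset.mem_insert_of_mem hc)) (contDiff_fst.add contDiff_snd)

theorem JetSmooth.eval (p : JetPoly n m) : JetSmooth Ω fun θ => MvPolynomial.eval θ p := by
  induction p using MvPolynomial.induction_on with
  | C a => simpa using JetSmooth.const Ω a
  | add p q hp hq =>
    simpa using hp.map₂ hq (op := fun a b => a + b) (contDiff_fst.add contDiff_snd)
  | mul_X p c hp => simpa using hp.mul (JetSmooth.coord Ω c)

instance decidableEqFinsetCoe (s : Finset (JetIdx n m)) : DecidableEq s :=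
  Subtype.instDecidableEq

section Chain

variable {s : Finset (JetIdx n m)} {G : (s → ℝ) → ℝ} {F : Jet n m → ℝ}

/-- Coordinatewise differentiability of the curve is enough, since `F` sees only the coordinates in
`s`. The formula for `F` holds only over `Ω`, where the curve stays near `t₀` by openness. -/
theorem hasDerivAt_comp_curve (hΩ : IsOpen Ω)
    (hG : ContDiffOn ℝ ∞ G (s.restrict '' jetSpace Ω))
    (hF : ∀ θ ∈ jetSpace Ω, F θ = G (s.restrict θ)) {γ : ℝ → Jet n m} {γ' : Jet n m} {t₀ : ℝ}
    (hγ : ∀ c, HasDerivAt (fun t => γ t c) (γ' c) t₀) (h₀ : γ t₀ ∈ jetSpace Ω) :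
    HasDerivAt (fun t => F (γ t))
      (∑ c : s, γ' c * fderiv ℝ G (s.restrict (γ t₀)) (Pi.single c 1)) t₀ := by
  have hU := isOpen_restrict_jetSpace hΩ s
  have hGd : HasFDerivAt G (fderiv ℝ G (s.restrict (γ t₀))) (s.restrict (γ t₀)) :=
    ((hG.contDiffAt (hU.mem_nhds ⟨_, h₀, rfl⟩)).differentiableAt (by simp)).hasFDerivAt
  have hγs : HasDerivAt (fun t => s.restrict (γ t)) (s.restrict γ') t₀ :=
    hasDerivAt_pi.2 fun c => hγ c
  have hcomp := hGd.comp_hasDerivAt t₀ hγs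
  have hev : (fun t => F (γ t)) =ᶠ[nhds t₀] fun t => G (s.restrict (γ t)) := by
    have hc : ContinuousAt (fun t => base (γ t)) t₀ :=
      continuousAt_pi.2 fun κ => (hγ (Sum.inl κ)).continuousAt
    filter_upwards [hc.eventually (hΩ.mem_nhds h₀)] with t ht
    exact hF _ ht
  exact (hcomp.congr_of_eventuallyEq hev).congr_deriv (clm_apply_eq_sum_single _ _)

theorem hasDerivAt_update (θ : Jet n m) (c d : JetIdx n m) :
    HasDerivAt (fun t => Function.update θ c t d) (if d = c then 1 else 0) (θ c) := by
  rcases eq_or_ne d c with rfl | h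
  · simpa using hasDerivAt_id' (θ d)
  · simpa [h] using hasDerivAt_const (θ c) (θ d)

theorem jetPartial_eq_fderiv (hΩ : IsOpen Ω)
    (hG : ContDiffOn ℝ ∞ G (s.restrict '' jetSpace Ω))
    (hF : ∀ θ ∈ jetSpace Ω, F θ = G (s.restrict θ)) {θ : Jet n m} (hθ : θ ∈ jetSpace Ω)
    (c : JetIdx n m) : jetPartial c F θ =
      if h : c ∈ s then fderiv ℝ G (s.restrict θ) (Pi.single ⟨c, h⟩ 1) else 0 := by
  have := hasDerivAt_comp_curve hΩ hG hF (γ := Function.update θ c) (t₀ := θ c)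
    (hasDerivAt_update θ c) (by simpa using hθ)
  rw [jetPartial, this.deriv, Function.update_eq_self]
  split_ifs with h
  · rw [Finset.sum_eq_single ⟨c, h⟩]
    · simp
    · rintro ⟨d, hd⟩ _ hne
      have : d ≠ c := fun h => hne (Subtype.ext h)
      simp [this]
    · simp
  · refine Finset.sum_eq_zero ?_
    rintro ⟨d, hd⟩ _
    have : d ≠ c := fun e => h (e ▸ hd)
    simp [this]

theorem sum_jetPartial (hΩ : IsOpen Ω)
    (hG : ContDiffOn ℝ ∞ G (s.restrict '' jetSpace Ω))
    (hF : ∀ θ ∈ jetSpace Ω, F θ = G (s.restrict θ)) {θ : Jet n m} (hθ : θ ∈ jetSpace Ω)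
    (a : JetIdx n m → ℝ) : ∑ c ∈ s, a c * jetPartial c F θ =
      ∑ c : s, a c * fderiv ℝ G (s.restrict θ) (Pi.single c 1) := by
  rw [← Finset.sum_coe_sort s]
  refine Finset.sum_congr rfl fun c _ => ?_
  rw [jetPartial_eq_fderiv hΩ hG hF hθ, dif_pos c.2]

end Chain

theorem JetSmooth.jetPartial (hΩ : IsOpen Ω) {F : Jet n m → ℝ} (hF : JetSmooth Ω F)
    (c : JetIdx n m) : JetSmooth Ω (jetPartial c F) := by
  obtain ⟨s, G, hG, hFG⟩ := hF
  by_cases h : c ∈ s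
  · refine ⟨s, fun y => fderiv ℝ G y (Pi.single ⟨c, h⟩ 1), ?_, fun θ hθ => ?_⟩
    · exact (hG.fderiv_of_isOpen (isOpen_restrict_jetSpace hΩ s) (by simp)).clm_apply
        contDiffOn_const
    · rw [jetPartial_eq_fderiv hΩ hG hFG hθ, dif_pos h]
  · refine ⟨s, fun _ => 0, contDiffOn_const, fun θ hθ => ?_⟩
    rw [jetPartial_eq_fderiv hΩ hG hFG hθ, dif_neg h]

end Smooth

/-! ### Vector fields on the equation -/

section Fields

variable {n m : ℕ} {Ω : Set (BaseIdx n m → ℝ)}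

/-- Evaluation at a point of the equation. -/
def ev (θ : flatEq Ω) : SmoothFun Ω →ₐ[ℝ] ℝ :=
  (Pi.evalAlgHom ℝ (fun _ : flatEq Ω => ℝ) θ).comp (SmoothFun Ω).val

theorem smoothFun_ext {f g : SmoothFun Ω} (h : ∀ θ, ev θ f = ev θ g) : f = g :=
  Subtype.ext (funext h)

@[simp] theorem ev_coord (θ : flatEq Ω) (c : JetIdx n m) : ev θ (coord Ω c) = θ.1 c := rfl

/-- A smooth function of finitely many coordinates, restricted to the equation. -/
def pull (Ω : Set (BaseIdx n m → ℝ)) (s : Finset (JetIdx n m)) (G : (s → ℝ) → ℝ)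
    (hG : ContDiff ℝ ∞ G) : SmoothFun Ω :=
  ⟨fun θ => G (s.restrict θ.1), fun θ => G (s.restrict θ),
    ⟨s, G, hG.contDiffOn, fun _ _ => rfl⟩, fun _ => rfl⟩

@[simp] theorem ev_pull (θ : flatEq Ω) (s : Finset (JetIdx n m)) (G : (s → ℝ) → ℝ)
    (hG : ContDiff ℝ ∞ G) : ev θ (pull Ω s G hG) = G (s.restrict θ.1) := rfl

/-- Hadamard's lemma at the point itself: in each product the factor `y_c - θ_c` vanishes there, so
Leibniz' rule leaves `X(y_c)` times the partial derivative. -/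
theorem ev_derivation_pull (X : VectorField Ω) (θ : flatEq Ω) (s : Finset (JetIdx n m))
    (G : (s → ℝ) → ℝ) (hG : ContDiff ℝ ∞ G) : ev θ (X (pull Ω s G hG)) =
      ∑ c : s, ev θ (X (coord Ω c)) * fderiv ℝ G (s.restrict θ.1) (Pi.single c 1) := by
  obtain ⟨H, hH, hGH, hHa⟩ := exists_hadamard hG (s.restrict θ.1)
  have h : pull Ω s G hG = algebraMap ℝ (SmoothFun Ω) (G (s.restrict θ.1)) +
      ∑ c : s, (coord Ω c - algebraMap ℝ (SmoothFun Ω) (θ.1 c)) * pull Ω s (H c) (hH c) := by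
    refine smoothFun_ext fun θ' => ?_
    rw [ev_pull, hGH, map_add, map_sum]
    simp only [map_mul, map_sub, AlgHom.commutes, ev_coord, ev_pull]
    rfl
  rw [h, map_add, Derivation.map_algebraMap, zero_add, map_sum, map_sum]
  refine Finset.sum_congr rfl fun c _ => ?_
  rw [Derivation.leibniz, map_sub, Derivation.map_algebraMap, sub_zero, map_add, smul_eq_mul,
    smul_eq_mul, map_mul, map_mul, map_sub, ev_coord, AlgHom.commutes, ev_pull, hHa]
  simp [mul_comm]

/-- Removes the assumption that `G` is smooth everywhere, by multiplying with a bump function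
supported where `G` is smooth. -/
theorem ev_derivation (hΩ : IsOpen Ω) (X : VectorField Ω) {f : SmoothFun Ω}
    {s : Finset (JetIdx n m)} {G : (s → ℝ) → ℝ}
    (hG : ContDiffOn ℝ ∞ G (s.restrict '' jetSpace Ω))
    (hf : ∀ θ, ev θ f = G (s.restrict θ.1)) (θ : flatEq Ω) : ev θ (X f) =
      ∑ c : s, ev θ (X (coord Ω c)) * fderiv ℝ G (s.restrict θ.1) (Pi.single c 1) := by
  have hU := isOpen_restrict_jetSpace hΩ s
  have ha : s.restrict θ.1 ∈ s.restrict '' jetSpace Ω := ⟨θ.1, θ.2.1, rfl⟩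
  obtain ⟨ε, hε, hball⟩ := Metric.isOpen_iff.1 hU _ ha
  let χ : ContDiffBump (s.restrict θ.1) := ⟨ε / 4, ε / 2, by positivity, by linarith⟩
  have hχ : ContDiff ℝ ∞ χ := χ.contDiff
  have hχ1 : ⇑χ =ᶠ[nhds (s.restrict θ.1)] fun _ => 1 := χ.eventuallyEq_one
  have hχG : ContDiff ℝ ∞ fun y => χ y * G y := by
    refine contDiff_iff_contDiffAt.2 fun y => ?_
    by_cases hy : y ∈ tsupport χ
    · refine hχ.contDiffAt.mul (hG.contDiffAt (hU.mem_nhds (hball ?_)))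
      rw [χ.tsupport_eq, Metric.mem_closedBall] at hy
      rw [Metric.mem_ball]
      exact hy.trans_lt (half_lt_self hε)
    · have h0 : (fun y => χ y * G y) =ᶠ[nhds y] fun _ => 0 := by
        filter_upwards [notMem_tsupport_iff_eventuallyEq.1 hy] with z hz
        simp [hz]
      exact contDiffAt_const.congr_of_eventuallyEq h0
  have hmul : pull Ω s χ hχ * f = pull Ω s _ hχG := by
    refine smoothFun_ext fun θ' => ?_
    rw [map_mul, ev_pull, ev_pull, hf]
  have h1 : ev θ (pull Ω s χ hχ) = 1 := by
    rw [ev_pull]; exact hχ1.self_of_nhds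
  have hdχ : ev θ (X (pull Ω s χ hχ)) = 0 := by
    rw [ev_derivation_pull, hχ1.fderiv_eq]
    simp
  have hdG : fderiv ℝ (fun y => χ y * G y) (s.restrict θ.1) = fderiv ℝ G (s.restrict θ.1) := by
    refine Filter.EventuallyEq.fderiv_eq ?_
    filter_upwards [hχ1] with y hy
    simp [hy]
  -- Leibniz' rule on `χ f = χ G`: at `θ` the bump has value `1` and derivative `0`, so both sides
  -- reduce to the desired ones.
  have := congrArg (fun g => ev θ (X g)) hmul
  simp only [Derivation.leibniz, smul_eq_mul, map_add, map_mul, h1, hdχ, mul_zero, add_zero,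
    one_mul, ev_derivation_pull, hdG] at this
  exact this

/-- The chain rule for vector fields on the equation and for curves in the jet space. -/
theorem exists_chain_rule (hΩ : IsOpen Ω) {F : Jet n m → ℝ} (hF : JetSmooth Ω F) :
    ∃ s : Finset (JetIdx n m), (∀ c ∉ s, ∀ θ ∈ jetSpace Ω, jetPartial c F θ = 0) ∧
      (∀ (γ : ℝ → Jet n m) (γ' : Jet n m) (t₀ : ℝ), (∀ c, HasDerivAt (fun t => γ t c) (γ' c) t₀) →
        γ t₀ ∈ jetSpace Ω → HasDerivAt (fun t => F (γ t))
          (∑ c ∈ s, γ' c * jetPartial c F (γ t₀)) t₀) ∧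
      ∀ (X : VectorField Ω) (f : SmoothFun Ω), (∀ θ, ev θ f = F θ.1) → ∀ θ, ev θ (X f) =
        ∑ c ∈ s, ev θ (X (coord Ω c)) * jetPartial c F θ.1 := by
  obtain ⟨s, G, hG, hFG⟩ := hF
  refine ⟨s, fun c hc θ hθ => ?_, fun γ γ' t₀ hγ h₀ => ?_, fun X f hf θ => ?_⟩
  · rw [jetPartial_eq_fderiv hΩ hG hFG hθ, dif_neg hc]
  · rw [sum_jetPartial hΩ hG hFG h₀]
    exact hasDerivAt_comp_curve hΩ hG hFG hγ h₀
  · rw [sum_jetPartial hΩ hG hFG θ.2.1 (fun c => ev θ (X (coord Ω c)))]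
    exact ev_derivation hΩ X hG (fun θ => (hf θ).trans (hFG _ θ.2.1)) θ

/-- A vector field is determined by its values on the jet coordinates. -/
theorem vectorField_ext_coord (hΩ : IsOpen Ω) {X Y : VectorField Ω}
    (h : ∀ c, X (coord Ω c) = Y (coord Ω c)) : X = Y := by
  refine Derivation.ext fun f => smoothFun_ext fun θ => ?_
  obtain ⟨F, hF, hf⟩ := f.2
  obtain ⟨s, -, -, hs⟩ := exists_chain_rule hΩ hF
  rw [hs X f hf, hs Y f hf]
  simp only [h]

/-- The special coordinates as functions on the equation. -/
def modelCoord (Ω : Set (BaseIdx n m → ℝ)) (c : ModelIdx n m) : SmoothFun Ω :=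
  ⟨fun θ => ofJet θ.1 c, fun θ => ofJet θ c, JetSmooth.eval _, fun _ => rfl⟩

/-- Polynomials in the special coordinates as functions on the equation. -/
abbrev modelFun (Ω : Set (BaseIdx n m → ℝ)) : ModelPoly n m →ₐ[ℝ] SmoothFun Ω :=
  MvPolynomial.aeval (modelCoord Ω)

@[simp] theorem ev_modelFun (θ : flatEq Ω) (p : ModelPoly n m) :
    ev θ (modelFun Ω p) = MvPolynomial.eval (ofJet θ.1) p := by
  induction p using MvPolynomial.induction_on with
  | C a => simp [← MvPolynomial.algebraMap_eq]
  | add p q hp hq => simp [hp, hq]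
  | mul_X p c hp =>
    rw [map_mul, map_mul, hp, MvPolynomial.aeval_X, map_mul, MvPolynomial.eval_X]
    rfl

theorem modelFun_jetToModel (c : JetIdx n m) : modelFun Ω (jetToModel c) = coord Ω c := by
  refine smoothFun_ext fun θ => ?_
  rw [ev_modelFun, ev_coord]
  exact congrFun (toJet_ofJet θ.2) c

theorem vectorField_ext (hΩ : IsOpen Ω) {X Y : VectorField Ω}
    (h : ∀ c, X (modelCoord Ω c) = Y (modelCoord Ω c)) : X = Y := by
  refine vectorField_ext_coord hΩ fun c => ?_
  rw [← modelFun_jetToModel]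
  generalize jetToModel c = p
  induction p using MvPolynomial.induction_on with
  | C a => simp [← MvPolynomial.algebraMap_eq]
  | add p q hp hq => simp [hp, hq]
  | mul_X p c hp => simp [hp, h]

/-- Extension of a function on the equation by zero. -/
def extend (f : SmoothFun Ω) (θ : Jet n m) : ℝ := by
  classical exact if h : θ ∈ flatEq Ω then f.1 ⟨θ, h⟩ else 0

theorem extend_eq (f : SmoothFun Ω) (θ : flatEq Ω) : extend f θ.1 = ev θ f := by
  rw [extend, dif_pos θ.2]; rfl

/-- The coordinate line of the special coordinate `c` through a jet. -/
def coordLine (c : ModelIdx n m) (θ : Jet n m) (t : ℝ) : Jet n m :=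
  toJet (Function.update (ofJet θ) c t)

theorem coordLine_self (c : ModelIdx n m) (θ : flatEq Ω) :
    coordLine c θ.1 (ofJet θ.1 c) = θ.1 := by
  rw [coordLine, Function.update_eq_self, toJet_ofJet θ.2]

/-- The line can leave the equation only through its base point leaving the open set `Ω`. -/
theorem coordLine_mem (hΩ : IsOpen Ω) (c : ModelIdx n m) (θ : flatEq Ω) :
    ∀ᶠ t in nhds (ofJet θ.1 c), coordLine c θ.1 t ∈ flatEq Ω := by
  have hcont : Continuous fun (t : ℝ) (κ : BaseIdx n m) =>
      Function.update (ofJet θ.1) c t (Sum.inl κ) :=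
    continuous_pi fun κ => (continuous_apply (Sum.inl κ)).comp
      (f := fun t : ℝ => Function.update (ofJet θ.1) c t) (continuous_const.update c continuous_id)
  have h0 : (fun κ : BaseIdx n m =>
      Function.update (ofJet θ.1) c (ofJet θ.1 c) (Sum.inl κ)) ∈ Ω := by
    rw [Function.update_eq_self, ← base_toJet, toJet_ofJet θ.2]
    exact θ.2.1
  filter_upwards [hcont.continuousAt.eventually (hΩ.mem_nhds h0)] with t ht
  exact toJet_mem ht

theorem hasDerivAt_coordLine (c : ModelIdx n m) (θ : Jet n m) (q : JetIdx n m) :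
    HasDerivAt (fun t => coordLine c θ t q)
      (MvPolynomial.eval (ofJet θ) (MvPolynomial.pderiv c (jetToModel q))) (ofJet θ c) :=
  hasDerivAt_eval_update _ _ _

theorem extend_coordLine_eventuallyEq (hΩ : IsOpen Ω) {f : SmoothFun Ω} {F : Jet n m → ℝ}
    (hf : ∀ θ : flatEq Ω, ev θ f = F θ.1) (c : ModelIdx n m) (θ : flatEq Ω) :
    (fun t => extend f (coordLine c θ.1 t)) =ᶠ[nhds (ofJet θ.1 c)]
      fun t => F (coordLine c θ.1 t) := by
  filter_upwards [coordLine_mem hΩ c θ] with t ht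
  exact (extend_eq f ⟨_, ht⟩).trans (hf ⟨_, ht⟩)

/-- The derivative of a function along a special coordinate line. -/
def lineDeriv (c : ModelIdx n m) (f : SmoothFun Ω) (θ : Jet n m) : ℝ :=
  deriv (fun t => extend f (coordLine c θ t)) (ofJet θ c)

/-- By the chain rule the derivative is a finite sum of jet partial derivatives with polynomial
coefficients, the velocities of the coordinate line; hence it is again a smooth function. -/
theorem exists_lineDeriv (hΩ : IsOpen Ω) (c : ModelIdx n m) (f : SmoothFun Ω) :
    ∃ F, JetSmooth Ω F ∧ ∀ θ : flatEq Ω, HasDerivAt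
      (fun t => extend f (coordLine c θ.1 t)) (F θ.1) (ofJet θ.1 c) := by
  obtain ⟨F, hF, hf⟩ := f.2
  obtain ⟨s, -, hs, -⟩ := exists_chain_rule hΩ hF
  refine ⟨fun θ => ∑ q ∈ s, MvPolynomial.eval (ofJet θ) (MvPolynomial.pderiv c (jetToModel q)) *
    jetPartial q F θ, JetSmooth.sum s fun q _ => ?_, fun θ => ?_⟩
  · simp only [eval_ofJet]
    exact (JetSmooth.eval _).mul (hF.jetPartial hΩ q)
  · have := hs (coordLine c θ.1) _ _ (hasDerivAt_coordLine c θ.1)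
      (by rw [coordLine_self]; exact θ.2.1)
    rw [coordLine_self] at this
    exact this.congr_of_eventuallyEq (extend_coordLine_eventuallyEq hΩ hf c θ)

theorem hasDerivAt_lineDeriv (hΩ : IsOpen Ω) (c : ModelIdx n m) (f : SmoothFun Ω) (θ : flatEq Ω) :
    HasDerivAt (fun t => extend f (coordLine c θ.1 t)) (lineDeriv c f θ.1) (ofJet θ.1 c) := by
  obtain ⟨F, -, h⟩ := exists_lineDeriv hΩ c f
  exact (h θ).differentiableAt.hasDerivAt

theorem lineDeriv_mem (hΩ : IsOpen Ω) (c : ModelIdx n m) (f : SmoothFun Ω) :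
    (fun θ : flatEq Ω => lineDeriv c f θ.1) ∈ SmoothFun Ω := by
  obtain ⟨F, hF, h⟩ := exists_lineDeriv hΩ c f
  exact ⟨F, hF, fun θ => (h θ).deriv⟩

theorem extend_add (f g : SmoothFun Ω) (θ : Jet n m) :
    extend (f + g) θ = extend f θ + extend g θ := by
  unfold extend; split_ifs <;> simp

theorem extend_smul (r : ℝ) (f : SmoothFun Ω) (θ : Jet n m) :
    extend (r • f) θ = r * extend f θ := by
  unfold extend; split_ifs <;> simp

theorem extend_mul (f g : SmoothFun Ω) (θ : Jet n m) :
    extend (f * g) θ = extend f θ * extend g θ := by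
  unfold extend; split_ifs <;> simp

/-- The coordinate vector field of a special coordinate. -/
def coordField (hΩ : IsOpen Ω) (c : ModelIdx n m) : VectorField Ω :=
  Derivation.mk'
    { toFun := fun f => ⟨fun θ => lineDeriv c f θ.1, lineDeriv_mem hΩ c f⟩
      map_add' := fun f g => Subtype.ext <| funext fun θ => by
        refine HasDerivAt.deriv ?_
        simp only [extend_add]
        exact (hasDerivAt_lineDeriv hΩ c f θ).fun_add (hasDerivAt_lineDeriv hΩ c g θ)
      map_smul' := fun r f => Subtype.ext <| funext fun θ => by
        refine HasDerivAt.deriv ?_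
        simp only [extend_smul]
        exact (hasDerivAt_lineDeriv hΩ c f θ).const_mul r }
    fun f g => Subtype.ext <| funext fun θ => by
      refine HasDerivAt.deriv ?_
      simp only [extend_mul]
      have := (hasDerivAt_lineDeriv hΩ c f θ).fun_mul (hasDerivAt_lineDeriv hΩ c g θ)
      rw [coordLine_self, extend_eq, extend_eq] at this
      refine this.congr_deriv ?_
      rw [mul_comm, add_comm]
      rfl

theorem coordField_modelCoord (hΩ : IsOpen Ω) (c c' : ModelIdx n m) :
    coordField hΩ c (modelCoord Ω c') = if c = c' then 1 else 0 := by
  refine smoothFun_ext fun θ => ?_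
  change lineDeriv c (modelCoord Ω c') θ.1 = _
  rw [lineDeriv, (extend_coordLine_eventuallyEq hΩ (F := fun θ => ofJet θ c')
    (fun _ => rfl) c θ).deriv_eq]
  simp only [coordLine, ofJet_toJet]
  refine HasDerivAt.deriv ?_
  rcases eq_or_ne c c' with rfl | h
  · simpa using hasDerivAt_id' (ofJet θ.1 c)
  · simpa [h, h.symm] using hasDerivAt_const (ofJet θ.1 c) (ofJet θ.1 c')

theorem coordField_modelFun (hΩ : IsOpen Ω) (c : ModelIdx n m) (p : ModelPoly n m) :
    coordField hΩ c (modelFun Ω p) = modelFun Ω (MvPolynomial.pderiv c p) := by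
  refine (map_derivation_of_generators _ (fun c' => ?_) p).symm
  rw [MvPolynomial.aeval_X, coordField_modelCoord, MvPolynomial.pderiv_X, Pi.single_apply]
  simp only [eq_comm (a := c)]
  split_ifs <;> simp

/-- Only finitely many special coordinate derivatives of a function are nonzero. -/
theorem finite_coordField (hΩ : IsOpen Ω) (f : SmoothFun Ω) :
    {c | coordField hΩ c f ≠ 0}.Finite := by
  classical
  obtain ⟨F, hF, hf⟩ := f.2
  obtain ⟨s, -, -, hs⟩ := exists_chain_rule hΩ hF
  refine (Finset.finite_toSet (s.biUnion fun q => (jetToModel q).vars)).subset fun c hc => ?_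
  by_contra h
  refine hc (smoothFun_ext fun θ => ?_)
  rw [hs _ f hf, map_zero]
  refine Finset.sum_eq_zero fun q hq => ?_
  have : c ∉ (jetToModel q).vars := fun h' => h (by
    simp only [Finset.coe_biUnion, Set.mem_iUnion, Finset.mem_coe]
    exact ⟨q, hq, h'⟩)
  rw [← modelFun_jetToModel, coordField_modelFun,
    MvPolynomial.pderiv_eq_zero_of_notMem_vars this, map_zero, map_zero, zero_mul]

/-- The vector field with given components in special coordinates. -/
def fieldOf (hΩ : IsOpen Ω) (b : ModelIdx n m → SmoothFun Ω) : VectorField Ω :=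
  Derivation.mk'
    { toFun := fun f => ∑ᶠ c, b c * coordField hΩ c f
      map_add' := fun f g => by
        simp only [map_add, mul_add]
        exact finsum_add_distrib
          ((finite_coordField hΩ f).subset fun c hc h => hc (by simp [h]))
          ((finite_coordField hΩ g).subset fun c hc h => hc (by simp [h]))
      map_smul' := fun r f => by
        simp only [Derivation.map_smul, RingHom.id_apply, mul_smul_comm]
        exact (smul_finsum r _).symm }
    fun f g => by
      have hf : (Function.support fun c => b c * coordField hΩ c f).Finite :=
        (finite_coordField hΩ f).subset fun c hc h => hc (by simp [h])
      have hg : (Function.support fun c => b c * coordField hΩ c g).Finite :=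
        (finite_coordField hΩ g).subset fun c hc h => hc (by simp [h])
      change ∑ᶠ c, b c * coordField hΩ c (f * g) =
        f * ∑ᶠ c, b c * coordField hΩ c g + g * ∑ᶠ c, b c * coordField hΩ c f
      rw [mul_finsum' _ _ hg, mul_finsum' _ _ hf, ← finsum_add_distrib
        (hg.subset fun c hc h => hc (by simp [h])) (hf.subset fun c hc h => hc (by simp [h]))]
      refine finsum_congr fun c => ?_
      simp only [Derivation.leibniz, smul_eq_mul]
      ring

theorem fieldOf_apply (hΩ : IsOpen Ω) (b : ModelIdx n m → SmoothFun Ω) (f : SmoothFun Ω) :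
    fieldOf hΩ b f = ∑ᶠ c, b c * coordField hΩ c f := rfl

@[simp] theorem fieldOf_modelCoord (hΩ : IsOpen Ω) (b : ModelIdx n m → SmoothFun Ω)
    (c : ModelIdx n m) : fieldOf hΩ b (modelCoord Ω c) = b c := by
  rw [fieldOf_apply, finsum_eq_single _ c]
  · simp [coordField_modelCoord]
  · intro c' h
    simp [coordField_modelCoord, h]

theorem isCoordinateFrame_modelCoord (hΩ : IsOpen Ω) :
    IsCoordinateFrame (modelCoord Ω) (coordField hΩ) where
  dual := coordField_modelCoord hΩ
  finite := finite_coordField hΩ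
  expand X f := by
    have : X = fieldOf hΩ fun c => X (modelCoord Ω c) := vectorField_ext hΩ fun c => by simp
    conv_lhs => rw [this]
    rfl

end Fields

/-! ### Vertical derivations and the coboundary of a tuple -/

section Coboundary

variable {n m : ℕ} {R : Type*} [CommRing R] [Algebra ℝ R] {d : BaseIdx n m → Derivation ℝ R R}
  {w : BaseIdx n m → R} {v : Fin n → Fin m → R}

/-- `∑_α h^α d_{v^α}`. -/
def vertD (d : BaseIdx n m → Derivation ℝ R R) (h : Fin m → R) : Derivation ℝ R R :=
  ∑ α : Fin m, h α • d (Sum.inr α)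

theorem vertD_apply (d : BaseIdx n m → Derivation ℝ R R) (h : Fin m → R) (f : R) :
    vertD d h f = ∑ α, h α * d (Sum.inr α) f := by
  simp [vertD, derivation_sum_apply]

/-- The components `ζ_i^α` of the coboundary of the tuple `h`. -/
def zeta (d : BaseIdx n m → Derivation ℝ R R) (v : Fin n → Fin m → R) (h : Fin m → R)
    (i : Fin n) (α : Fin m) : R :=
  horD d v i (h α) - vertD d h (v i α)

namespace FlatSystem

theorem vertD_inr (H : FlatSystem d w v) (h : Fin m → R) (α : Fin m) :
    vertD d h (w (Sum.inr α)) = h α := by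
  simp [vertD_apply, H.dual]

theorem vertD_inl (H : FlatSystem d w v) (h : Fin m → R) (i : Fin n) :
    vertD d h (w (Sum.inl i)) = 0 := by
  simp [vertD_apply, H.dual]

theorem horD_vert (H : FlatSystem d w v) (i : Fin n) (β : Fin m) (f : R) :
    horD d v i (d (Sum.inr β) f) =
      d (Sum.inr β) (horD d v i f) - ∑ γ, d (Sum.inr β) (v i γ) * d (Sum.inr γ) f := by
  rw [horD_apply, horD_apply, map_add, map_sum, H.comm (Sum.inl i)]
  simp only [Derivation.leibniz, smul_eq_mul, Finset.sum_add_distrib, H.comm (Sum.inr β),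
    mul_comm (d (Sum.inr _) f)]
  ring

/-- This is where `ζ` originates: it collects the components of the vertical field `[D_i, V_h]`. -/
theorem horD_vertD (H : FlatSystem d w v) (h : Fin m → R) (i : Fin n) (f : R) :
    horD d v i (vertD d h f) =
      vertD d h (horD d v i f) + ∑ β, zeta d v h i β * d (Sum.inr β) f := by
  have h₁ : ∑ β, vertD d h (v i β) * d (Sum.inr β) f =
      ∑ β, h β * ∑ γ, d (Sum.inr β) (v i γ) * d (Sum.inr γ) f := by
    simp only [vertD_apply, Finset.sum_mul, Finset.mul_sum]
    rw [Finset.sum_comm]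
    simp only [mul_assoc]
  simp only [zeta, sub_mul, Finset.sum_sub_distrib, h₁]
  rw [vertD_apply, map_sum, vertD_apply]
  simp only [Derivation.leibniz, smul_eq_mul, H.horD_vert, mul_sub, Finset.sum_add_distrib,
    Finset.sum_sub_distrib, mul_comm (d (Sum.inr _) f)]
  ring

/-- Since `V_h` kills `x_i`, the terms in which `V_h` differentiates `Z(x_i)` cancel, and only
`[D_i, V_h]` survives. -/
theorem nijenhuis_apply (H : FlatSystem d w v) (h : Fin m → R) (Z : Derivation ℝ R R) (f : R) :
    ∑ i, Z (w (Sum.inl i)) * horD d v i (vertD d h f) -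
        vertD d h (∑ i, Z (w (Sum.inl i)) * horD d v i f) -
        ∑ i, ⁅Z, vertD d h⁆ (w (Sum.inl i)) * horD d v i f =
      ∑ i, Z (w (Sum.inl i)) * ∑ α, zeta d v h i α * d (Sum.inr α) f := by
  simp only [map_sum, ← Finset.sum_sub_distrib]
  refine Finset.sum_congr rfl fun i _ => ?_
  rw [Derivation.commutator_apply, H.vertD_inl, map_zero, Derivation.leibniz, smul_eq_mul,
    smul_eq_mul, H.horD_vertD]
  ring

theorem vertD_vertD (H : FlatSystem d w v) (f g : Fin m → R) (F : R) :
    vertD d f (vertD d g F) - vertD d g (vertD d f F) =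
      vertD d (fun α => vertD d f (g α) - vertD d g (f α)) F := by
  have key : ∀ f g : Fin m → R, vertD d f (vertD d g F) =
      ∑ α, vertD d f (g α) * d (Sum.inr α) F +
        ∑ α, ∑ β, f β * g α * d (Sum.inr β) (d (Sum.inr α) F) := by
    intro f g
    rw [vertD_apply d g, map_sum, ← Finset.sum_add_distrib]
    refine Finset.sum_congr rfl fun α _ => ?_
    rw [Derivation.leibniz, smul_eq_mul, smul_eq_mul, vertD_apply d f (d _ F), Finset.mul_sum,
      add_comm, mul_comm (d (Sum.inr α) F)]
    congr 1
    exact Finset.sum_congr rfl fun β _ => by ring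
  have h₁ : ∑ α, ∑ β, f β * g α * d (Sum.inr β) (d (Sum.inr α) F) =
      ∑ α, ∑ β, g β * f α * d (Sum.inr β) (d (Sum.inr α) F) := by
    rw [Finset.sum_comm]
    refine Finset.sum_congr rfl fun α _ => Finset.sum_congr rfl fun β _ => ?_
    rw [H.comm (Sum.inr α), mul_comm (f α)]
  rw [key, key, h₁, vertD_apply]
  simp only [sub_mul, Finset.sum_sub_distrib]
  ring

/-- A derivation commuting with the `d_κ` fails to commute with `D_i` by a vertical term. -/
theorem apply_horD {S : Derivation ℝ R R} (hS : ∀ κ f, S (d κ f) = d κ (S f)) (i : Fin n)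
    (f : R) : S (horD d v i f) = horD d v i (S f) + ∑ β, S (v i β) * d (Sum.inr β) f := by
  rw [horD_apply, horD_apply, map_add, map_sum, hS]
  simp only [Derivation.leibniz, smul_eq_mul, hS, Finset.sum_add_distrib,
    mul_comm (d (Sum.inr _) f)]
  ring

theorem apply_vertD {S : Derivation ℝ R R} (hS : ∀ κ f, S (d κ f) = d κ (S f)) (h : Fin m → R)
    (f : R) : S (vertD d h f) = vertD d h (S f) + vertD d (fun α => S (h α)) f := by
  simp only [vertD_apply, map_sum, Derivation.leibniz, smul_eq_mul, hS, Finset.sum_add_distrib,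
    mul_comm (d (Sum.inr _) f)]

/-- If `S` commutes with the `d_κ` and has components `ζ(h)`, then `S + V_h` commutes with the
`D_i`. -/
theorem add_vertD_horD (H : FlatSystem d w v) {S : Derivation ℝ R R}
    (hS : ∀ κ f, S (d κ f) = d κ (S f)) {h : Fin m → R} (hζ : ∀ i α, S (v i α) = zeta d v h i α)
    (i : Fin n) (f : R) :
    (S + vertD d h) (horD d v i f) = horD d v i ((S + vertD d h) f) := by
  rw [Derivation.add_apply, Derivation.add_apply, apply_horD hS, map_add, H.horD_vertD]
  simp only [hζ]
  ring

theorem commutator_add_vertD (H : FlatSystem d w v) {S T : Derivation ℝ R R}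
    (hS : ∀ κ f, S (d κ f) = d κ (S f)) (hT : ∀ κ f, T (d κ f) = d κ (T f)) (f g : Fin m → R) :
    ⁅S + vertD d f, T + vertD d g⁆ =
      ⁅S, T⁆ + vertD d fun α => S (g α) - T (f α) + vertD d f (g α) - vertD d g (f α) := by
  refine Derivation.ext fun F => ?_
  have h₁ := H.vertD_vertD f g F
  have h₂ : vertD d (fun α => S (g α) - T (f α) + vertD d f (g α) - vertD d g (f α)) F =
      vertD d (fun α => S (g α)) F - vertD d (fun α => T (f α)) F +
        vertD d (fun α => vertD d f (g α) - vertD d g (f α)) F := by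
    rw [vertD_apply, vertD_apply, vertD_apply, vertD_apply, ← Finset.sum_sub_distrib,
      ← Finset.sum_add_distrib]
    exact Finset.sum_congr rfl fun α _ => by ring
  simp only [Derivation.commutator_apply, Derivation.add_apply, map_add, apply_vertD hS,
    apply_vertD hT, h₂, ← h₁]
  ring

/-- The components of the commutator are those of the bracket of tuples. -/
theorem commutator_zeta (H : FlatSystem d w v) {S T : Derivation ℝ R R}
    (hS : ∀ κ f, S (d κ f) = d κ (S f)) (hT : ∀ κ f, T (d κ f) = d κ (T f)) {f g : Fin m → R}
    (hf : ∀ i α, S (v i α) = zeta d v f i α) (hg : ∀ i α, T (v i α) = zeta d v g i α)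
    (hSw : ∀ κ, S (w κ) = 0) (hTw : ∀ κ, T (w κ) = 0) (i : Fin n) (α : Fin m) :
    ⁅S, T⁆ (v i α) = zeta d v
      (fun α => S (g α) - T (f α) + vertD d f (g α) - vertD d g (f α)) i α := by
  set k : Fin m → R := fun α => S (g α) - T (f α) + vertD d f (g α) - vertD d g (f α) with hk
  have hC := H.commutator_add_vertD hS hT f g
  rw [← hk] at hC
  have hcomm : ∀ F, (⁅S, T⁆ + vertD d k) (horD d v i F) = horD d v i ((⁅S, T⁆ + vertD d k) F) := by
    intro F
    rw [← hC]
    simp only [Derivation.commutator_apply, H.add_vertD_horD hS hf, H.add_vertD_horD hT hg, map_sub]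
  -- Both `S` and `T` kill `v^α`, and `D_i v^α = v_i^α`; so on `v^α` the commutation with `D_i`
  -- expresses the components of `[S, T]` through the tuple `k`.
  have := hcomm (w (Sum.inr α))
  have hw : ⁅S, T⁆ (w (Sum.inr α)) = 0 := by simp [Derivation.commutator_apply, hSw, hTw]
  rw [H.horD_inr, Derivation.add_apply, Derivation.add_apply, H.vertD_inr, hw, zero_add] at this
  rw [zeta, ← this]
  ring

end FlatSystem

end Coboundary

/-! ### The total derivatives on the equation -/

section Total

open MvPolynomial

variable {n m : ℕ} {Ω : Set (BaseIdx n m → ℝ)}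

/-- The restriction of the total derivative to the equation. -/
def totalD (hΩ : IsOpen Ω) (κ : BaseIdx n m) : VectorField Ω :=
  fieldOf hΩ fun c => modelFun Ω (modelD κ (X c))

theorem totalD_modelFun (hΩ : IsOpen Ω) (κ : BaseIdx n m) (p : ModelPoly n m) :
    modelFun Ω (modelD κ p) = totalD hΩ κ (modelFun Ω p) := by
  refine map_derivation_of_generators _ (fun c => ?_) p
  rw [aeval_X]
  exact (fieldOf_modelCoord hΩ (fun c => modelFun Ω (modelD κ (X c))) c).symm

theorem totalD_base (hΩ : IsOpen Ω) (κ μ : BaseIdx n m) :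
    totalD hΩ κ (coord Ω (Sum.inl μ)) = if μ = κ then 1 else 0 := by
  rw [← modelFun_jetToModel, ← totalD_modelFun, jetToModel, modelFlatSystem.dual]
  split_ifs <;> simp

theorem totalD_jet (hΩ : IsOpen Ω) (κ : BaseIdx n m) (i : Fin n) (α : Fin m)
    (σ : Multiset (BaseIdx n m)) :
    totalD hΩ κ (coord Ω (Sum.inr (i, α, σ))) = coord Ω (Sum.inr (i, α, κ ::ₘ σ)) := by
  rw [← modelFun_jetToModel, ← totalD_modelFun, ← jetToModel_cons, modelFun_jetToModel]

/-- The field has the right values on jet coordinates, and the chain rule extends this to any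
representative `F`; in particular the choice of `F` is immaterial. -/
theorem isTotalDerivative_totalD (hΩ : IsOpen Ω) (κ : BaseIdx n m) :
    IsTotalDerivative κ (totalD hΩ κ) := by
  classical
  intro f F hF hf θ
  obtain ⟨s, hs, -, hX⟩ := exists_chain_rule hΩ hF
  refine (hX (totalD hΩ κ) f hf θ).trans ?_
  have hsub : (Function.support fun q : Fin n × Fin m × Multiset (BaseIdx n m) =>
      θ.1 (Sum.inr (q.1, q.2.1, κ ::ₘ q.2.2)) * jetPartial (Sum.inr q) F θ.1) ⊆
      (s.toRight : Set _) := by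
    intro q hq
    by_contra h
    refine hq ?_
    simp only [Finset.mem_coe, Finset.mem_toRight] at h
    simp [hs _ h _ θ.2.1]
  rw [jetTotal, finsum_eq_sum_of_support_subset _ hsub, ← Finset.toLeft_disjSum_toRight (u := s),
    Finset.sum_disjSum]
  simp only [totalD_base, Finset.toLeft_disjSum_toRight]
  congr 1
  · simp only [apply_ite (ev θ), map_one, map_zero, ite_mul, one_mul, zero_mul,
      Finset.sum_ite_eq', Finset.mem_toLeft]
    split_ifs with h
    · rfl
    · exact (hs _ h _ θ.2.1).symm
  · refine Finset.sum_congr (by simp) fun q _ => ?_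
    rw [show q = (q.1, q.2.1, q.2.2) from rfl, totalD_jet, ev_coord]

theorem modelFun_modelV (i : Fin n) (α : Fin m) : modelFun Ω (modelV i α) = connCoeff Ω i α := by
  rw [← jetToModel_zero, modelFun_jetToModel]; rfl

theorem commute_of_modelCoord (hΩ : IsOpen Ω) {Y Z : VectorField Ω}
    (h : ∀ c, Y (Z (modelCoord Ω c)) = Z (Y (modelCoord Ω c))) (f : SmoothFun Ω) :
    Y (Z f) = Z (Y f) := by
  have : ⁅Y, Z⁆ = 0 := vectorField_ext hΩ fun c => by simp [Derivation.commutator_apply, h]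
  have := congrArg (fun D => D f) this
  simpa [Derivation.commutator_apply, sub_eq_zero] using this

theorem totalFlatSystem (hΩ : IsOpen Ω) :
    FlatSystem (totalD hΩ) (fun κ => coord Ω (Sum.inl κ)) (connCoeff Ω) where
  comm κ μ f := by
    refine commute_of_modelCoord hΩ (fun c => ?_) f
    rw [← aeval_X (R := ℝ) (modelCoord Ω) c, ← totalD_modelFun, ← totalD_modelFun,
      ← totalD_modelFun, ← totalD_modelFun, modelFlatSystem.comm]
  dual κ μ := totalD_base hΩ κ μ
  flat i j α := by
    rw [← modelFun_modelV, ← modelFun_modelV,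
      ← map_horD _ (totalD_modelFun hΩ) modelFun_modelV,
      ← map_horD _ (totalD_modelFun hΩ) modelFun_modelV, modelFlatSystem.flat]

theorem aeval_coord_jetD (hΩ : IsOpen Ω) (κ : BaseIdx n m) (p : JetPoly n m) :
    aeval (coord Ω) (jetD κ p) = totalD hΩ κ (aeval (coord Ω) p) := by
  refine map_derivation_of_generators _ (fun c => ?_) p
  rcases c with μ | ⟨i, α, σ⟩
  · rw [jetD_base, aeval_X, totalD_base]
    split_ifs <;> simp
  · rw [jetD_jet, aeval_X, aeval_X, totalD_jet]

theorem ev_aeval_coord (θ : flatEq Ω) (p : JetPoly n m) :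
    ev θ (aeval (coord Ω) p) = eval θ.1 p := by
  induction p using MvPolynomial.induction_on with
  | C a => simp [← MvPolynomial.algebraMap_eq]
  | add p q hp hq => simp [hp, hq]
  | mul_X p c hp => simp [hp]

theorem modelCoord_inl (κ : BaseIdx n m) : modelCoord Ω (Sum.inl κ) = coord Ω (Sum.inl κ) :=
  smoothFun_ext fun θ => by
    rw [← aeval_X (R := ℝ) (coord Ω) (Sum.inl κ), ev_aeval_coord]
    rfl

theorem modelCoord_inr (hΩ : IsOpen Ω) (q : SpecialIdx n m) : modelCoord Ω (Sum.inr q) =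
    special (totalD hΩ) q.1.1 q.1.2.1.toList q.1.2.2.toList := by
  have h : modelCoord Ω (Sum.inr q) = aeval (coord Ω) (modelToJet (Sum.inr q)) :=
    smoothFun_ext fun θ => (ev_aeval_coord θ _).symm
  rw [h]
  exact map_specialOf _ (aeval_coord_jetD hΩ) (fun κ => aeval_X _ _) (fun i α => aeval_X _ _)
    _ _ _

theorem specialSystem_totalD (hΩ : IsOpen Ω) : specialSystem (totalD hΩ) = modelCoord Ω := by
  funext c
  rcases c with κ | q
  · exact (modelCoord_inl κ).symm
  · exact (modelCoord_inr hΩ q).symm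

theorem special_eq (hΩ : IsOpen Ω) (α : Fin m) (I : List (Fin n)) (A : List (Fin m)) :
    special (totalD hΩ) α I A =
      specialOf (totalD hΩ) (fun κ => coord Ω (Sum.inl κ)) (connCoeff Ω) α I A := rfl

theorem modelCoord_mk (hΩ : IsOpen Ω) (α : Fin m) (I : List (Fin n)) (A : List (Fin m))
    (hI : (I : Multiset (Fin n)) ≠ 0) : modelCoord Ω (Sum.inr ⟨(α, I, A), hI⟩) =
      specialOf (totalD hΩ) (fun κ => coord Ω (Sum.inl κ)) (connCoeff Ω) α I A := by
  rw [modelCoord_inr hΩ, special_eq]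
  refine (totalFlatSystem hΩ).specialOf_perm α ?_ ?_ <;> rw [← Multiset.coe_eq_coe] <;> simp

theorem coord_eq_iter (hΩ : IsOpen Ω) (i : Fin n) (α : Fin m) (σ : Multiset (BaseIdx n m)) :
    coord Ω (Sum.inr (i, α, σ)) = iter (totalD hΩ) σ.toList (connCoeff Ω i α) := by
  rw [← modelFun_jetToModel, ← modelFun_modelV]
  exact map_iter _ (totalD_modelFun hΩ) _ _

end Total

/-! ### Symmetries -/

section Symmetry

open MvPolynomial

variable {n m : ℕ} {Ω : Set (BaseIdx n m → ℝ)}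

theorem nijenhuis_connForm {D : BaseIdx n m → VectorField Ω}
    (H : FlatSystem D (fun κ => coord Ω (Sum.inl κ)) (connCoeff Ω)) (h : Fin m → SmoothFun Ω)
    (Z : VectorField Ω) : nijenhuis (connForm D) (vert D h) Z =
      vertForm D (zeta D (connCoeff Ω) h) Z := by
  have hconn : ∀ (Y : VectorField Ω) f, connForm D Y f =
      ∑ i, Y (xCoord Ω i) * horD D (connCoeff Ω) i f := fun Y f => by
    rw [connForm, derivation_sum_apply]; rfl
  have hvf : ∀ f, vertForm D (zeta D (connCoeff Ω) h) Z f =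
      ∑ i, Z (xCoord Ω i) * ∑ α, zeta D (connCoeff Ω) h i α * D (Sum.inr α) f := fun f => by
    rw [vertForm, derivation_sum_apply]
    refine Finset.sum_congr rfl fun i _ => ?_
    rw [derivation_sum_apply, Finset.mul_sum]
    exact Finset.sum_congr rfl fun α _ => mul_assoc _ _ _
  refine Derivation.ext fun f => ?_
  rw [nijenhuis, Derivation.sub_apply, Derivation.commutator_apply, hconn, hconn, hconn, hvf]
  exact H.nijenhuis_apply h Z f

theorem jetSmooth_base {g : (BaseIdx n m → ℝ) → ℝ} (hg : ContDiffOn ℝ ∞ g Ω) :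
    JetSmooth Ω fun θ => g (base θ) := by
  classical
  let s : Finset (JetIdx n m) := Finset.univ.image Sum.inl
  have hs : ∀ κ, Sum.inl κ ∈ s := fun κ => Finset.mem_image_of_mem _ (Finset.mem_univ κ)
  refine ⟨s, fun y => g fun κ => y ⟨Sum.inl κ, hs κ⟩, ?_, fun θ _ => rfl⟩
  refine ContDiffOn.comp (g := g) (f := fun (y : s → ℝ) κ => y ⟨Sum.inl κ, hs κ⟩) hg ?_ ?_
  · exact (contDiff_pi.2 fun c => contDiff_apply ℝ ℝ _).contDiffOn
  · rintro _ ⟨θ, hθ, rfl⟩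
    exact hθ

theorem jetPartial_inr_base (g : (BaseIdx n m → ℝ) → ℝ)
    (q : Fin n × Fin m × Multiset (BaseIdx n m)) (θ : Jet n m) :
    jetPartial (Sum.inr q) (fun θ => g (base θ)) θ = 0 := by
  have : ∀ t, base (Function.update θ (Sum.inr q) t) = base θ := fun t => by
    funext κ; simp [base]
  simp [jetPartial, this]

/-- Symmetries are the vector fields that vanish on base coordinates and commute with the total
derivatives. -/
theorem isSymmetry_iff (hΩ : IsOpen Ω) (T : VectorField Ω) : IsSymmetry (totalD hΩ) T ↔
    (∀ κ, T (coord Ω (Sum.inl κ)) = 0) ∧ ∀ κ f, T (totalD hΩ κ f) = totalD hΩ κ (T f) := by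
  constructor
  · intro hT
    have hw : ∀ κ, T (coord Ω (Sum.inl κ)) = 0 := fun κ =>
      hT.vertical _ (fun b => b κ) (contDiff_apply ℝ ℝ κ).contDiffOn fun _ => rfl
    refine ⟨hw, fun κ f => ?_⟩
    obtain ⟨a, ha⟩ := (Submodule.mem_span_range_iff_exists_fun _).1
      (hT.preserves _ (Submodule.subset_span ⟨κ, rfl⟩))
    -- On base coordinates the `D_μ` are dual, whereas `[T, D_κ]` vanishes: `T` kills the
    -- coordinates and the constants `D_κ w^μ`.
    have ha0 : ∀ μ, a μ = 0 := fun μ => by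
      have := congrArg (fun X => X (coord Ω (Sum.inl μ))) ha
      simp only [derivation_sum_apply, Derivation.smul_apply, totalD_base, smul_eq_mul, mul_ite,
        mul_one, mul_zero, Finset.sum_ite_eq, Finset.mem_univ, if_true,
        Derivation.commutator_apply, hw, map_zero, sub_zero] at this
      rw [this]
      split_ifs <;> simp
    have := congrArg (fun X => X f) ha
    simp only [ha0, zero_smul, Finset.sum_const_zero, Derivation.commutator_apply,
      Derivation.zero_apply] at this
    exact (sub_eq_zero.1 this.symm)
  · rintro ⟨hw, hT⟩
    refine ⟨fun f g hg hf => smoothFun_ext fun θ => ?_, fun Y hY => ?_⟩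
    · obtain ⟨s, -, -, hs⟩ := exists_chain_rule hΩ (jetSmooth_base hg)
      rw [hs T f hf, map_zero]
      refine Finset.sum_eq_zero fun c _ => ?_
      rcases c with κ | q
      · rw [hw, map_zero, zero_mul]
      · rw [jetPartial_inr_base, mul_zero]
    · induction hY using Submodule.span_induction with
      | mem Y hY =>
        obtain ⟨κ, rfl⟩ := hY
        have : ⁅T, totalD hΩ κ⁆ = 0 := Derivation.ext fun f => by
          simp [Derivation.commutator_apply, hT]
        rw [this]
        exact zero_mem _
      | zero =>
        have : ⁅T, (0 : VectorField Ω)⁆ = 0 := Derivation.ext fun f => by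
          simp [Derivation.commutator_apply]
        rw [this]
        exact zero_mem _
      | add Y Z _ _ hY hZ =>
        have : ⁅T, Y + Z⁆ = ⁅T, Y⁆ + ⁅T, Z⁆ := Derivation.ext fun f => by
          simp only [Derivation.commutator_apply, Derivation.add_apply, map_add]
          ring
        rw [this]
        exact add_mem hY hZ
      | smul a Y hY hTY =>
        have : ⁅T, a • Y⁆ = a • ⁅T, Y⁆ + T a • Y := Derivation.ext fun f => by
          simp only [Derivation.commutator_apply, Derivation.smul_apply, Derivation.add_apply,
            Derivation.leibniz, smul_eq_mul]
          ring
        rw [this]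
        exact add_mem (Submodule.smul_mem _ _ hTY) (Submodule.smul_mem _ _ hY)

theorem isSymmetryOf_iff (hΩ : IsOpen Ω) (h : Fin m → SmoothFun Ω) (T : VectorField Ω) :
    IsSymmetryOf (totalD hΩ) h T ↔ (∀ κ, T (coord Ω (Sum.inl κ)) = 0) ∧
      (∀ κ f, T (totalD hΩ κ f) = totalD hΩ κ (T f)) ∧
      ∀ i α, T (connCoeff Ω i α) = zeta (totalD hΩ) (connCoeff Ω) h i α := by
  have hn : nijenhuis (connForm (totalD hΩ)) (vert (totalD hΩ) h) =
      vertForm (totalD hΩ) (zeta (totalD hΩ) (connCoeff Ω) h) :=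
    funext (nijenhuis_connForm (totalFlatSystem hΩ) h)
  -- A vertical form determines its components: insert `D_{x_i}` and apply the result to `v^α`.
  have hinj : ∀ φ (i : Fin n) (α : Fin m), vertForm (totalD hΩ) φ (totalD hΩ (Sum.inl i))
      (vCoord Ω α) = φ i α := fun φ i α => by
    rw [vertForm, derivation_sum_apply]
    simp only [derivation_sum_apply, xCoord, vCoord, Derivation.smul_apply, totalD_base,
      smul_eq_mul, Sum.inl.injEq, Sum.inr.injEq, mul_ite, mul_one, mul_zero, ite_mul, one_mul,
      zero_mul, Finset.sum_ite_eq, Finset.mem_univ, if_true, Finset.sum_ite_eq']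
  rw [IsSymmetryOf, isSymmetry_iff, hn, and_assoc]
  refine and_congr_right fun _ => and_congr_right fun _ => ⟨fun hT i α => ?_, fun hT => ?_⟩
  · rw [← hinj (zeta (totalD hΩ) (connCoeff Ω) h) i α, ← hT, hinj]
  · simp only [hT]

/-- Jet coordinates are iterated total derivatives of the `v_i^α`, so commutation propagates the
prescribed values to all of them. -/
theorem isSymmetryOf_unique (hΩ : IsOpen Ω) {h : Fin m → SmoothFun Ω} {S T : VectorField Ω}
    (hS : IsSymmetryOf (totalD hΩ) h S) (hT : IsSymmetryOf (totalD hΩ) h T) : T = S := by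
  rw [isSymmetryOf_iff] at hS hT
  refine vectorField_ext_coord hΩ fun c => ?_
  rcases c with κ | ⟨i, α, σ⟩
  · rw [hS.1, hT.1]
  · rw [coord_eq_iter hΩ, apply_iter hS.2.1, apply_iter hT.2.1, hS.2.2, hT.2.2]

/-- The component of the symmetry along `v_I^α`. -/
def symCoeff (hΩ : IsOpen Ω) (h : Fin m → SmoothFun Ω) (α : Fin m) (I : List (Fin n)) :
    SmoothFun Ω :=
  iter (horD (totalD hΩ) (connCoeff Ω)) I (h α) -
    vertD (totalD hΩ) h (iter (horD (totalD hΩ) (connCoeff Ω)) I (coord Ω (Sum.inl (Sum.inr α))))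

theorem symCoeff_perm (hΩ : IsOpen Ω) (h : Fin m → SmoothFun Ω) (α : Fin m)
    {I I' : List (Fin n)} (hI : I.Perm I') : symCoeff hΩ h α I = symCoeff hΩ h α I' := by
  rw [symCoeff, symCoeff, iter_perm (totalFlatSystem hΩ).horD_comm hI,
    iter_perm (totalFlatSystem hΩ).horD_comm hI]

theorem symCoeff_cons (hΩ : IsOpen Ω) (h : Fin m → SmoothFun Ω) (α : Fin m) (i : Fin n)
    (I : List (Fin n)) : symCoeff hΩ h α (i :: I) =
      horD (totalD hΩ) (connCoeff Ω) i (symCoeff hΩ h α I) +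
        ∑ β, zeta (totalD hΩ) (connCoeff Ω) h i β * totalD hΩ (Sum.inr β)
          (iter (horD (totalD hΩ) (connCoeff Ω)) I (coord Ω (Sum.inl (Sum.inr α)))) := by
  rw [symCoeff, symCoeff, iter_cons, iter_cons, map_sub, (totalFlatSystem hΩ).horD_vertD]
  ring

theorem symCoeff_singleton (hΩ : IsOpen Ω) (h : Fin m → SmoothFun Ω) (α : Fin m) (i : Fin n) :
    symCoeff hΩ h α [i] = zeta (totalD hΩ) (connCoeff Ω) h i α := by
  rw [symCoeff, iter_cons, iter_cons, iter_nil, iter_nil, (totalFlatSystem hΩ).horD_inr, zeta]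

/-- The components of the symmetry in special coordinates. -/
def symComponent (hΩ : IsOpen Ω) (h : Fin m → SmoothFun Ω) : ModelIdx n m → SmoothFun Ω
  | Sum.inl _ => 0
  | Sum.inr q => iter (fun β => totalD hΩ (Sum.inr β)) q.1.2.2.toList
      (symCoeff hΩ h q.1.1 q.1.2.1.toList)

/-- The symmetry attached to the tuple `h`. -/
def symField (hΩ : IsOpen Ω) (h : Fin m → SmoothFun Ω) : VectorField Ω :=
  fieldOf hΩ (symComponent hΩ h)

theorem symField_base (hΩ : IsOpen Ω) (h : Fin m → SmoothFun Ω) (κ : BaseIdx n m) :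
    symField hΩ h (coord Ω (Sum.inl κ)) = 0 := by
  rw [← modelCoord_inl]
  exact fieldOf_modelCoord hΩ _ _

theorem symField_specialOf_of_ne (hΩ : IsOpen Ω) (h : Fin m → SmoothFun Ω) (α : Fin m)
    (I : List (Fin n)) (A : List (Fin m)) (hI : (I : Multiset (Fin n)) ≠ 0) :
    symField hΩ h (specialOf (totalD hΩ) (fun κ => coord Ω (Sum.inl κ)) (connCoeff Ω) α I A) =
      iter (fun β => totalD hΩ (Sum.inr β)) A (symCoeff hΩ h α I) := by
  rw [← modelCoord_mk hΩ α I A hI]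
  refine (fieldOf_modelCoord hΩ _ _).trans ?_
  change iter _ (A : Multiset (Fin m)).toList (symCoeff hΩ h α (I : Multiset (Fin n)).toList) = _
  rw [symCoeff_perm hΩ h α (I' := I) (by rw [← Multiset.coe_eq_coe]; simp)]
  exact iter_perm (fun _ _ => (totalFlatSystem hΩ).comm _ _)
    (by rw [← Multiset.coe_eq_coe]; simp) _

/-- The empty word is not a special coordinate, but the closed formula still fits: there it reads
`h^α - h^α = 0`. -/
theorem symField_iter (hΩ : IsOpen Ω) (h : Fin m → SmoothFun Ω) (α : Fin m)
    (I : List (Fin n)) : symField hΩ h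
      (iter (horD (totalD hΩ) (connCoeff Ω)) I (coord Ω (Sum.inl (Sum.inr α)))) =
      symCoeff hΩ h α I := by
  rcases eq_or_ne I [] with rfl | hI
  · rw [iter_nil, symField_base, symCoeff, iter_nil, iter_nil, (totalFlatSystem hΩ).vertD_inr,
      sub_self]
  · exact symField_specialOf_of_ne hΩ h α I [] (by simpa using hI)

theorem symField_connCoeff (hΩ : IsOpen Ω) (h : Fin m → SmoothFun Ω) (i : Fin n) (α : Fin m) :
    symField hΩ h (connCoeff Ω i α) = zeta (totalD hΩ) (connCoeff Ω) h i α := by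
  rw [← symCoeff_singleton, ← symField_iter, iter_cons, iter_nil, (totalFlatSystem hΩ).horD_inr]

/-- To check that a vector field commutes with a derivation it suffices to look at base coordinates
and at the functions `D_{v^A} D_I v^α`. -/
theorem commute_of_specialOf (hΩ : IsOpen Ω) {Y Z : VectorField Ω}
    (hbase : ∀ κ, Y (Z (coord Ω (Sum.inl κ))) = Z (Y (coord Ω (Sum.inl κ))))
    (hspec : ∀ α (I : List (Fin n)) A, (I : Multiset (Fin n)) ≠ 0 →
      Y (Z (specialOf (totalD hΩ) (fun κ => coord Ω (Sum.inl κ)) (connCoeff Ω) α I A)) =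
      Z (Y (specialOf (totalD hΩ) (fun κ => coord Ω (Sum.inl κ)) (connCoeff Ω) α I A)))
    (f : SmoothFun Ω) : Y (Z f) = Z (Y f) := by
  refine commute_of_modelCoord hΩ (fun c => ?_) f
  rcases c with κ | q
  · rw [modelCoord_inl, hbase]
  · rw [modelCoord_inr hΩ]
    exact hspec _ _ _ (by simpa using q.2)

theorem symField_totalD_base (hΩ : IsOpen Ω) (h : Fin m → SmoothFun Ω) (κ μ : BaseIdx n m) :
    symField hΩ h (totalD hΩ κ (coord Ω (Sum.inl μ))) =
      totalD hΩ κ (symField hΩ h (coord Ω (Sum.inl μ))) := by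
  rw [totalD_base, symField_base, map_zero]
  split_ifs <;> simp

/-- The components were defined as vertical derivatives of those with `A = ∅`, so adding a letter to
`A` is compatible with the field. -/
theorem symField_totalD_vert (hΩ : IsOpen Ω) (h : Fin m → SmoothFun Ω) (β : Fin m)
    (f : SmoothFun Ω) : symField hΩ h (totalD hΩ (Sum.inr β) f) =
      totalD hΩ (Sum.inr β) (symField hΩ h f) := by
  refine commute_of_specialOf hΩ (symField_totalD_base hΩ h _) (fun α I A hI => ?_) f
  rw [symField_specialOf_of_ne hΩ h α I A hI]
  exact symField_specialOf_of_ne hΩ h α I (β :: A) hI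

theorem symField_specialOf (hΩ : IsOpen Ω) (h : Fin m → SmoothFun Ω) (α : Fin m)
    (I : List (Fin n)) (A : List (Fin m)) :
    symField hΩ h (specialOf (totalD hΩ) (fun κ => coord Ω (Sum.inl κ)) (connCoeff Ω) α I A) =
      iter (fun β => totalD hΩ (Sum.inr β)) A (symCoeff hΩ h α I) := by
  rw [specialOf, apply_iter (symField_totalD_vert hΩ h), symField_iter]

theorem symField_totalD (hΩ : IsOpen Ω) (h : Fin m → SmoothFun Ω) (κ : BaseIdx n m)
    (f : SmoothFun Ω) : symField hΩ h (totalD hΩ κ f) = totalD hΩ κ (symField hΩ h f) := by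
  rcases κ with i | β
  swap
  · exact symField_totalD_vert hΩ h β f
  have H := totalFlatSystem hΩ
  refine commute_of_specialOf hΩ (symField_totalD_base hΩ h _) (fun α I A _ => ?_) f
  rw [symField_specialOf, specialOf, apply_iter (fun β => H.comm _ _),
    apply_iter (symField_totalD_vert hΩ h), apply_iter (fun β => H.comm _ _)]
  congr 1
  -- With `A` stripped off, `D_{x_i}` is rewritten through `D_i`. The `ζ`-term of `symCoeff_cons`
  -- then cancels the contribution of `S_h` acting on the coefficients `v_i^β`.
  have hx : ∀ f, totalD hΩ (Sum.inl i) f = horD (totalD hΩ) (connCoeff Ω) i f -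
      ∑ β, connCoeff Ω i β * totalD hΩ (Sum.inr β) f := fun f => by
    rw [horD_apply]; ring
  rw [hx, map_sub, map_sum, ← iter_cons, symField_iter, symCoeff_cons, hx]
  simp only [Derivation.leibniz, smul_eq_mul, symField_connCoeff, symField_totalD_vert,
    symField_iter, Finset.sum_add_distrib,
    mul_comm (totalD hΩ _ (iter (horD (totalD hΩ) (connCoeff Ω)) I _))]
  ring

theorem isSymmetryOf_symField (hΩ : IsOpen Ω) (h : Fin m → SmoothFun Ω) :
    IsSymmetryOf (totalD hΩ) h (symField hΩ h) :=
  (isSymmetryOf_iff hΩ h _).2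
    ⟨symField_base hΩ h, symField_totalD hΩ h, symField_connCoeff hΩ h⟩

theorem zeta_add (D : BaseIdx n m → VectorField Ω) (f g : Fin m → SmoothFun Ω) (i : Fin n)
    (α : Fin m) : zeta D (connCoeff Ω) (f + g) i α =
      zeta D (connCoeff Ω) f i α + zeta D (connCoeff Ω) g i α := by
  simp only [zeta, vertD_apply, Pi.add_apply, map_add, add_mul, Finset.sum_add_distrib]
  ring

theorem zeta_smul (D : BaseIdx n m → VectorField Ω) (r : ℝ) (f : Fin m → SmoothFun Ω) (i : Fin n)
    (α : Fin m) : zeta D (connCoeff Ω) (r • f) i α = r • zeta D (connCoeff Ω) f i α := by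
  simp only [zeta, vertD_apply, Pi.smul_apply, Derivation.map_smul, smul_mul_assoc,
    ← Finset.smul_sum, smul_sub]

/-- The linear map from tuples of functions to symmetries. -/
def symMap (hΩ : IsOpen Ω) : (Fin m → SmoothFun Ω) →ₗ[ℝ] VectorField Ω where
  toFun := symField hΩ
  map_add' f g := by
    -- Linearity comes from uniqueness, since `ζ` is linear in the tuple.
    refine (isSymmetryOf_unique hΩ (h := f + g) ?_ (isSymmetryOf_symField hΩ _))
    refine (isSymmetryOf_iff hΩ _ _).2 ⟨fun κ => ?_, fun κ F => ?_, fun i α => ?_⟩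
    · simp [symField_base]
    · simp [symField_totalD]
    · simp [symField_connCoeff, zeta_add]
  map_smul' r f := by
    refine (isSymmetryOf_unique hΩ (h := r • f) ?_ (isSymmetryOf_symField hΩ _))
    refine (isSymmetryOf_iff hΩ _ _).2 ⟨fun κ => ?_, fun κ F => ?_, fun i α => ?_⟩
    · simp [symField_base]
    · simp [symField_totalD]
    · simp [symField_connCoeff, zeta_smul]

@[simp] theorem symMap_apply (hΩ : IsOpen Ω) (h : Fin m → SmoothFun Ω) :
    symMap hΩ h = symField hΩ h := rfl

theorem commutator_symMap (hΩ : IsOpen Ω) (f g : Fin m → SmoothFun Ω) :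
    ⁅symMap hΩ f, symMap hΩ g⁆ = symMap hΩ (bracket (totalD hΩ) (symMap hΩ) f g) := by
  refine isSymmetryOf_unique hΩ (isSymmetryOf_symField hΩ _) ?_
  refine (isSymmetryOf_iff hΩ _ _).2 ⟨fun κ => ?_, fun κ F => ?_, fun i α => ?_⟩
  · simp [Derivation.commutator_apply, symField_base]
  · simp [Derivation.commutator_apply, symField_totalD]
  · exact (totalFlatSystem hΩ).commutator_zeta (symField_totalD hΩ f) (symField_totalD hΩ g)
      (symField_connCoeff hΩ f) (symField_connCoeff hΩ g) (symField_base hΩ f)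
      (symField_base hΩ g) i α

end Symmetry

/-! ### Injectivity -/

section Order

open MvPolynomial

variable {n m : ℕ} {Ω : Set (BaseIdx n m → ℝ)}

/-- The order `|I|` of a special coordinate. -/
def order : ModelIdx n m → ℕ
  | Sum.inl _ => 0
  | Sum.inr q => q.1.2.1.card

/-- Polynomials in the special coordinates of order at most `k`. -/
def orderLE (n m k : ℕ) : Subalgebra ℝ (ModelPoly n m) := supported ℝ {c | order c ≤ k}

theorem modelY_mem_orderLE {k : ℕ} (α : Fin m) (I : Multiset (Fin n)) (A : Multiset (Fin m))
    (hI : I ≠ 0) (h : I.card ≤ k) : modelY α I A hI ∈ orderLE n m k :=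
  Algebra.subset_adjoin ⟨_, h, rfl⟩

theorem modelVert_mem_orderLE {k : ℕ} (β : Fin m) {p : ModelPoly n m} (hp : p ∈ orderLE n m k) :
    modelVert β p ∈ orderLE n m k := by
  induction hp using Algebra.adjoin_induction with
  | mem p hp =>
    obtain ⟨c, hc, rfl⟩ := hp
    rcases c with κ | ⟨⟨α, I, A⟩, hI⟩
    · rw [modelVert_base]
      split_ifs
      · exact one_mem _
      · exact zero_mem _
    · exact (modelVert_modelY α β I A hI).symm ▸ modelY_mem_orderLE α I (β ::ₘ A) hI hc
  | algebraMap r => simp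
  | add p q _ _ hp hq => rw [map_add]; exact add_mem hp hq
  | mul p q hp' hq' hp hq =>
    rw [Derivation.leibniz]
    exact add_mem (mul_mem hp' hq) (mul_mem hq' hp)

theorem pderiv_eq_zero_of_mem_orderLE {k : ℕ} {p : ModelPoly n m} (hp : p ∈ orderLE n m k)
    {c : ModelIdx n m} (hc : k < order c) : pderiv c p = 0 :=
  pderiv_eq_zero_of_notMem_vars fun h => (mem_supported.1 hp h).not_gt hc

/-- The leading term of `D_i`: moving `D_i` past a vertical derivation produces only products of
functions of order `1` and `|I|`, which is at most `|I|` because `I` is nonempty. -/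
theorem horD_modelY_sub_mem (i : Fin n) (α : Fin m) (I : Multiset (Fin n)) (A : Multiset (Fin m))
    (hI : I ≠ 0) : horD modelD modelV i (modelY α I A hI) -
      modelY α (i ::ₘ I) A Multiset.cons_ne_zero ∈ orderLE n m I.card := by
  have hpos : 1 ≤ I.card := Multiset.card_pos.2 hI
  induction A using Multiset.induction_on with
  | empty => rw [horD_modelY, sub_self]; exact zero_mem _
  | cons β A ih =>
    have h₁ : horD modelD modelV i (modelY α I (β ::ₘ A) hI) =
        modelVert β (horD modelD modelV i (modelY α I A hI)) -
          ∑ γ, modelVert β (modelV i γ) * modelVert γ (modelY α I A hI) := by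
      rw [← modelVert_modelY]
      exact modelFlatSystem.horD_vert i β _
    rw [h₁, ← modelVert_modelY, sub_right_comm, ← map_sub]
    refine sub_mem (modelVert_mem_orderLE β ih) (sum_mem fun γ _ => mul_mem ?_ ?_)
    · exact modelVert_mem_orderLE β (modelY_mem_orderLE _ _ _ _ (by simpa using hpos))
    · exact modelVert_mem_orderLE γ (modelY_mem_orderLE _ _ _ _ le_rfl)

theorem horD_base_eq (i : Fin n) (κ : BaseIdx n m) :
    horD (R := ModelPoly n m) modelD modelV i (X (Sum.inl κ)) =
      Sum.elim (fun j => if j = i then 1 else 0) (modelV i) κ := by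
  rcases κ with j | α
  · exact modelFlatSystem.horD_inl i j
  · exact modelFlatSystem.horD_inr i α

/-- The commutator of a coordinate vector field and `D_i` in special coordinates. -/
theorem coordField_horD (hΩ : IsOpen Ω) (e : ModelIdx n m) (i : Fin n) (f : SmoothFun Ω) :
    coordField hΩ e (horD (totalD hΩ) (connCoeff Ω) i f) =
      horD (totalD hΩ) (connCoeff Ω) i (coordField hΩ e f) +
        ∑ᶠ c, modelFun Ω (pderiv e (horD modelD modelV i (X c))) * coordField hΩ c f := by
  have h := (isCoordinateFrame_modelCoord hΩ).expand
    ⁅coordField hΩ e, horD (totalD hΩ) (connCoeff Ω) i⁆ f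
  have h₁ : ∀ c, ⁅coordField hΩ e, horD (totalD hΩ) (connCoeff Ω) i⁆ (modelCoord Ω c) =
      modelFun Ω (pderiv e (horD modelD modelV i (X c))) := fun c => by
    rw [Derivation.commutator_apply, coordField_modelCoord, ← coordField_modelFun hΩ,
      map_horD (modelFun Ω) (totalD_modelFun hΩ) modelFun_modelV, aeval_X]
    split_ifs <;> simp
  simp only [h₁] at h
  rw [← h, Derivation.commutator_apply]
  ring

/-- Among the coordinates of order at most `k`, only `v_I^{α,A}` has a `D_i`-derivative containing
`e = v_{iI}^{α,A}`, and it does so with coefficient `1`. -/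
theorem pderiv_horD_of_order_le {e : ModelIdx n m} {i : Fin n} {k : ℕ} (hk : 1 ≤ k)
    (he : k < order e) {c : ModelIdx n m} (hc : order c ≤ k) {α : Fin m} {I : Multiset (Fin n)}
    {A : Multiset (Fin m)} (hI : I ≠ 0)
    (h : e = Sum.inr ⟨(α, i ::ₘ I, A), Multiset.cons_ne_zero⟩) :
    pderiv e (horD modelD modelV i (X c)) = if c = Sum.inr ⟨(α, I, A), hI⟩ then 1 else 0 := by
  rcases c with κ | ⟨⟨α', I', A'⟩, hI'⟩
  · rw [horD_base_eq, if_neg Sum.inl_ne_inr]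
    refine pderiv_eq_zero_of_mem_orderLE (k := k) ?_ he
    rcases κ with j | α
    · simp only [Sum.elim_inl]
      split_ifs
      · exact one_mem _
      · exact zero_mem _
    · exact modelY_mem_orderLE _ _ _ _ (by simpa using hk)
  · have h₁ := pderiv_eq_zero_of_mem_orderLE (horD_modelY_sub_mem i α' I' A' hI')
      (c := e) (lt_of_le_of_lt hc he)
    rw [map_sub, sub_eq_zero] at h₁
    refine h₁.trans ?_
    rw [modelY, pderiv_X, Pi.single_apply, h]
    simp [Multiset.cons_inj_right]

theorem symField_injective (hΩ : IsOpen Ω) (hn : 0 < n) :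
    Function.Injective (symMap hΩ : (Fin m → SmoothFun Ω) →ₗ[ℝ] VectorField Ω) := by
  rw [injective_iff_map_eq_zero]
  intro h hh
  -- The equation `ζ_i = 0` for a single direction already forces `h = 0`.
  let i : Fin n := ⟨0, hn⟩
  have heq : ∀ α, horD (totalD hΩ) (connCoeff Ω) i (h α) =
      ∑ γ, h γ * modelFun Ω (modelY α {i} {γ} (Multiset.singleton_ne_zero i)) := by
    intro α
    have h₁ : zeta (totalD hΩ) (connCoeff Ω) h i α = 0 := by
      rw [← symField_connCoeff, ← symMap_apply, hh, Derivation.zero_apply]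
    rw [zeta, sub_eq_zero] at h₁
    rw [h₁, vertD_apply]
    refine Finset.sum_congr rfl fun γ _ => ?_
    rw [← modelFun_modelV, ← totalD_modelFun]
    congr 2
    exact modelVert_modelY _ _ _ _ _
  -- Descending induction on the order of `h`. The bound `1 ≤ k` keeps the coefficients `v_i^{α,γ}`,
  -- of order `1`, independent of coordinates of order `k + 1`.
  have hstep : ∀ k, 1 ≤ k → (∀ c, k < order c → ∀ α, coordField hΩ c (h α) = 0) →
      ∀ c, order c = k → ∀ α, coordField hΩ c (h α) = 0 := by
    intro k hk hvan c hc α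
    rcases c with κ | ⟨⟨α', I, A⟩, hI⟩
    · exact absurd hc (by simp [order]; omega)
    replace hI : I ≠ 0 := hI
    have hcard : I.card = k := hc
    -- Differentiating `D_i h^α` along this coordinate of order `k + 1` isolates the derivative of
    -- `h^α` along `v_I^{α',A}`.
    let e : ModelIdx n m := Sum.inr ⟨(α', i ::ₘ I, A), Multiset.cons_ne_zero⟩
    have he : k < order e := by simp [e, order, hcard]
    have h₁ := coordField_horD hΩ e i (h α)
    rw [hvan e he, map_zero, zero_add, finsum_eq_single _ (Sum.inr ⟨(α', I, A), hI⟩)] at h₁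
    · rw [pderiv_horD_of_order_le hk he hc.le hI rfl, if_pos rfl, map_one, one_mul] at h₁
      rw [← h₁, heq, map_sum]
      refine Finset.sum_eq_zero fun γ _ => ?_
      rw [Derivation.leibniz, hvan e he, coordField_modelFun,
        pderiv_eq_zero_of_mem_orderLE (k := k) (modelY_mem_orderLE _ _ _ _ (by simpa using hk)) he]
      simp
    · intro c' hc'
      rcases le_or_gt (order c') k with hle | hlt
      · rw [pderiv_horD_of_order_le hk he hle hI rfl, if_neg hc', map_zero, zero_mul]
      · rw [hvan c' hlt, mul_zero]
  have hbound : ∃ K, ∀ c, K < order c → ∀ α, coordField hΩ c (h α) = 0 := by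
    have hfin : (⋃ α, {c | coordField hΩ c (h α) ≠ 0}).Finite :=
      Set.finite_iUnion fun α => finite_coordField hΩ (h α)
    obtain ⟨K, hK⟩ := (hfin.image order).bddAbove
    refine ⟨K, fun c hc α => ?_⟩
    by_contra hne
    exact hc.not_ge (hK ⟨c, Set.mem_iUnion.2 ⟨α, hne⟩, rfl⟩)
  have hzero : ∀ c, 0 < order c → ∀ α, coordField hΩ c (h α) = 0 := by
    obtain ⟨K, hK⟩ := hbound
    induction K with
    | zero => exact hK
    | succ k ih =>
      refine ih fun c hc α => ?_
      rcases (Nat.succ_le_of_lt hc).eq_or_lt with heq | hlt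
      · exact hstep (k + 1) (by omega) hK c heq.symm α
      · exact hK c hlt α
  funext γ
  -- Now `h` depends on `x, v` only, so `D_i h^γ` involves no order-one coordinates except the
  -- `v_i^β`. It is thus independent of `v_i^{γ,γ}`, whose coefficient on the other side is `h^γ`.
  let e : ModelIdx n m := Sum.inr ⟨(γ, {i}, {γ}), Multiset.singleton_ne_zero i⟩
  have he : 0 < order e := by simp [e, order]
  have h₁ := coordField_horD hΩ e i (h γ)
  rw [hzero e he, map_zero, zero_add, finsum_eq_zero_of_forall_eq_zero, heq, map_sum,
    Finset.sum_eq_single γ] at h₁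
  · rw [Derivation.leibniz, hzero e he, coordField_modelFun, modelY, pderiv_X_self] at h₁
    simpa using h₁
  · intro γ' _ hne
    rw [Derivation.leibniz, hzero e he, coordField_modelFun, modelY, pderiv_X_of_ne]
    · simp
    · simpa [e] using hne
  · simp
  · intro c
    rcases c with κ | q
    · rw [horD_base_eq]
      have : pderiv e (Sum.elim (fun j => if j = i then (1 : ModelPoly n m) else 0) (modelV i) κ) =
          0 := by
        rcases κ with j | α
        · simp only [Sum.elim_inl]
          split_ifs <;> simp
        · exact pderiv_X_of_ne (by simp [e])
      rw [this, map_zero, zero_mul]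
    · rw [hzero (Sum.inr q) (Multiset.card_pos.2 q.2), mul_zero]

end Order

end FlatConn

end

/-! ### The proposition, assembled -/

open FlatConn in
theorem proposition4p4 (n m : ℕ) (Ω : Set (BaseIdx n m → ℝ)) (hΩ : IsOpen Ω) :
    -- the total derivatives restrict to the equation
    ∃ D : BaseIdx n m → VectorField Ω, (∀ κ, IsTotalDerivative κ (D κ)) ∧
    -- each tuple `h` has exactly one symmetry `S h` with generating section `⟦Ū, V_h⟧`
    ∃ S : (Fin m → SmoothFun Ω) →ₗ[ℝ] VectorField Ω,
      (∀ h, IsSymmetryOf D h (S h) ∧ ∀ T, IsSymmetryOf D h T → T = S h) ∧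
      (0 < n → Function.Injective S) ∧
      -- the commutator of symmetries is the bracket of tuples
      (∀ f g, ⁅S f, S g⁆ = S (bracket D S f g)) ∧
      -- special coordinates and their coordinate vector fields
      (∀ (α : Fin m) (I I' : List (Fin n)) (A A' : List (Fin m)), I.Perm I' → A.Perm A' →
        special D α I A = special D α I' A') ∧
      ∃ P : BaseIdx n m ⊕ SpecialIdx n m → VectorField Ω,
        IsCoordinateFrame (specialSystem D) P ∧
        -- the coefficients of `S h` in special coordinates
        ∀ h : Fin m → SmoothFun Ω,
          (∀ f, S h f = ∑ᶠ q : SpecialIdx n m,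
            S h (special D q.1.1 q.1.2.1.toList q.1.2.2.toList) * P (Sum.inr q) f) ∧
          (∀ (i : Fin n) (β : Fin m), S h (special D β [i] []) =
            hor D i (h β) - ∑ γ : Fin m, special D β [i] [γ] * h γ) ∧
          (∀ (α : Fin m) (I : List (Fin n)) (A : List (Fin m)),
            S h (special D α I A) = vertIter D A (S h (special D α I []))) ∧
          (∀ (α : Fin m) (I : List (Fin n)) (i : Fin n),
            S h (special D α (I ++ [i]) []) = hor D i (S h (special D α I [])) +
              ∑ β : Fin m, special D α I [β] * S h (special D β [i] [])) := by
  have H := totalFlatSystem hΩ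
  refine ⟨totalD hΩ, isTotalDerivative_totalD hΩ, symMap hΩ,
    fun h => ⟨isSymmetryOf_symField hΩ h, fun T => isSymmetryOf_unique hΩ
      (isSymmetryOf_symField hΩ h)⟩, symField_injective hΩ, commutator_symMap hΩ,
    fun α I I' A A' => H.specialOf_perm α, coordField hΩ,
    specialSystem_totalD hΩ ▸ isCoordinateFrame_modelCoord hΩ, fun h => ⟨fun f => ?_,
      fun i β => ?_, fun α I A => ?_, fun α I i => ?_⟩⟩
  · rw [symMap_apply, (isCoordinateFrame_modelCoord hΩ).expand (symField hΩ h) f]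
    simp only [← modelCoord_inr]
    -- The frame expansion runs over all coordinates; the base terms vanish since `S_h` is vertical.
    rw [← finsum_mem_range (f := fun c => symField hΩ h (modelCoord Ω c) * coordField hΩ c f)
      (Sum.inr_injective (α := BaseIdx n m))]
    refine finsum_congr fun c => ?_
    rcases c with κ | q
    · rw [modelCoord_inl, symField_base, zero_mul]
      simp
    · simp
  · rw [symMap_apply, special_eq, symField_specialOf, iter_nil, symCoeff_singleton, zeta,
      vertD_apply]
    congr 1
    refine Finset.sum_congr rfl fun γ _ => ?_
    rw [special_eq, H.specialOf_singleton, mul_comm]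
    rfl
  · rw [symMap_apply, special_eq, special_eq, symField_specialOf, symField_specialOf]
    rfl
  -- The recursion was proved for a letter in front of the word; order independence moves the
  -- appended letter there.
  · rw [special_eq, H.specialOf_perm α (List.perm_append_singleton i I) (List.Perm.refl []),
      symMap_apply, symField_specialOf, iter_nil, symCoeff_cons, special_eq, symField_specialOf,
      iter_nil]
    congr 1
    refine Finset.sum_congr rfl fun β _ => ?_
    rw [special_eq, special_eq, symField_specialOf, iter_nil, symCoeff_singleton, mul_comm]
    rfl
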